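/- **Conventions.** Metric spaces are complete and non-empty, $G$ is a finitely generated group, group actions on metric spaces are by isometries, and $\mathcal{X}$ is a class of metric spaces (membership is understood up to isometry). For an action $\alpha\colon G\curvearrowright X$ and $M\leqslant G$ let $X^{\alpha(M)}$ be the set of points fixed by $M$. The pair $G\geqslant M$ has *relative property* $(\mathrm{F}_{\mathcal{X}})$ if $X^{\alpha(M)}\neq\emptyset$ for every $X\in\mathcal{X}$ and every action $\alpha\colon G\curvearrowright X$; $G$ has *property* $(\mathrm{F}_{\mathcal{X}})$ if $G\geqslant G$ has relative property $(\mathrm{F}_{\mathcal{X}})$. In a uniquely geodesic space (every pair of points is joined by a unique minimal geodesic segment) let $[x,y]$ be the oriented segment from $x$ to $y$, let $m_t[x,y]$ ($0\le t\le 1$) be its point at distance $t\,d(x,y)$ from $x$, and write $[x,y]\,\|\,[x',y']$ if $d(x,x')=d(y,y')=d(m_{1/2}[x,y],m_{1/2}[x',y'])$. **Assumptions on $\mathcal{X}$.** - $(\mathrm{S}_+)$: if $(X,d)\in\mathcal{X}$ and $r\ge 1$, then $(X,rd)\in\mathcal{X}$. - $(\mathrm{U})$: there is a non-principal ultrafilter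 $\mathcal{U}$ on $\mathbb{N}$ such that for all $X_n\in\mathcal{X}$ and $w_n\in X_n$ the pointed metric ultraproduct $\lim_{\mathcal{U}}(X_n,w_n)$ (sequences with $\sup_n d(x_n,w_n)<\infty$ and distance $\lim_{\mathcal{U}}d(x_n,y_n)$, modulo distance zero) belongs to $\mathcal{X}$ after forgetting the base point. - $(\Theta\text{-}\mathrm{NPC}1)$, for a strictly increasing continuous function $\Theta\colon\mathbb{R}_{\ge0}\to\mathbb{R}_{\ge0}$: every $X\in\mathcal{X}$ is uniquely geodesic, and $\Theta(d(m_t[x,y],m_t[x',y']))\le(1-t)\Theta(d(x,x'))+t\Theta(d(y,y'))$ for all segments $[x,y],[x',y']$ in $X$ and all $0\le t\le1$. - $(\mathrm{NPC}2)$: in every $X\in\mathcal{X}$, $[x,y]\,\|\,[x',y']$ implies $[x,x']\,\|\,[y,y']$. - $(\mathrm{NPC}3)$: in every $X\in\mathcal{X}$, if $[x,y]\,\|\,[y,z]$, then the concatenation $[x,y]\cup[y,z]$ is a geodesic segment. - $(\mathrm{TP})$: in every $X\in\mathcal{X}$, $[x,y]\,\|\,[x',y']$ and $[x',y']\,\|\,[x'',y'']$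 imply $[x,y]\,\|\,[x'',y'']$. **The games.** Let $l\ge3$, $M_1,\dots,M_l\leqslant G$ and $\Pi\leqslant\mathrm{Aut}(G)$. In the one-player game $(\mathrm{Game}_l^+)$ for $(M_1,\dots,M_l,\Pi)$, a position is an $l$-tuple $(H_1,\dots,H_l)$ of subgroups of $G$; the initial position is $(M_1,\dots,M_l)$; the player wins if finitely many moves lead to a position with $H_i=G$ for some $i$. The moves are: - Type $(\mathrm{I}^+)$: choose $\tau\in\mathrm{Sym}(l)$ with at least one fixed point and a subset $P\subseteq G$ with $hH_ih^{-1}\geqslant M_{\tau(i)}$ for all $h\in P$ and all $i$; replace $H_i$ by $\langle H_i,P\rangle$ for every $i$ with $\tau(i)=i$, and keep the other $H_j$. - Type $(\mathrm{II})$: choose $\sigma\in\mathrm{Sym}(l)$ and a subset $\Lambda\subseteq\mathrm{Inn}(G)\cdot\Pi$ with $H_i\geqslant\phi(M_{\sigma(i)})$ for all $\phi\in\Lambda$ and all $i$; replace simultaneously every $H_i$ by $\langle H_i,\bigcup_{\phi\in\Lambda}\phi(H_{\sigma(i)})\rangle$. The game $(\mathrm{Game}_l)$ is the same, except that in moves of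 type $(\mathrm{I}^+)$ the abelianization of $\langle P\rangle$ is moreover required to be a torsion group. **Theorem.** Let $\mathcal{X}$ satisfy $(\mathrm{S}_+)$, $(\mathrm{U})$, $(\Theta\text{-}\mathrm{NPC}1)$ for some $\Theta$, $(\mathrm{NPC}2)$, $(\mathrm{NPC}3)$ and $(\mathrm{TP})$. Let $l\ge3$, let $M_1,\dots,M_l\leqslant G$ be subgroups whose union generates $G$, and let $\Pi\leqslant\mathrm{Aut}(G)$ be finite. Assume that $G\geqslant M_i$ has relative property $(\mathrm{F}_{\mathcal{X}})$ for every $1\le i\le l$. 1. If $(\mathrm{Game}_l)$ for $(M_1,\dots,M_l,\Pi)$ can be won, then $G$ has property $(\mathrm{F}_{\mathcal{X}})$. 2. If, in addition, either all members of $\mathcal{X}$ are Banach spaces or all members of $\mathcal{X}$ are $\mathrm{CAT}(0)$ spaces, and $(\mathrm{Game}_l^+)$ for $(M_1,\dots,M_l,\Pi)$ can be won, then $G$ has property $(\mathrm{F}_{\mathcal{X}})$. -/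

import Mathlib

open scoped NNReal unitInterval

universe u v

namespace Synthesis

/-! ### Metric spaces, geodesics and parallelism -/

/-- A (non-empty, complete) metric space; a class of metric spaces is a `Set` of these. -/
structure MSpace : Type (u + 1) where
  carrier : Type u
  [metric : MetricSpace carrier]
  [complete : CompleteSpace carrier]
  [nonempty : Nonempty carrier]

instance : CoeSort MSpace.{u} (Type u) := ⟨MSpace.carrier⟩

instance (X : MSpace.{u}) : MetricSpace X := X.metric

instance (X : MSpace.{u}) : CompleteSpace X := X.complete

instance (X : MSpace.{u}) : Nonempty X := X.nonempty

section Geodesics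

variable (X : Type u) [MetricSpace X]

variable {X} in
/-- `γ` is a (minimal) geodesic segment from `x` to `y`, parametrized proportionally to arc length
by `[0, 1]`. So `γ t` divides the segment internally at ratio `t : (1 - t)`. -/
def IsGeodesic (x y : X) (γ : I → X) : Prop :=
  γ 0 = x ∧ γ 1 = y ∧ ∀ s t : I, dist (γ s) (γ t) = |(s : ℝ) - t| * dist x y

/-- Every ordered pair of points is connected by a unique geodesic segment. -/
def UniquelyGeodesic : Prop :=
  ∀ x y : X, ∃! γ : I → X, IsGeodesic x y γ

/-- The parameter `1 / 2` of the midpoint of a segment. -/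
noncomputable def half : I := ⟨1 / 2, by norm_num, by norm_num⟩

variable {X} in
/-- `[x, y] ∥ [x', y']` (in a uniquely geodesic space). -/
def Parallel (x y x' y' : X) : Prop :=
  ∃ γ γ' : I → X, IsGeodesic x y γ ∧ IsGeodesic x' y' γ' ∧
    dist x x' = dist y y' ∧ dist y y' = dist (γ half) (γ' half)

/-- Transitivity of parallelism. -/
def TP : Prop :=
  ∀ x y x' y' x'' y'' : X, Parallel x y x' y' → Parallel x' y' x'' y'' → Parallel x y x'' y''

/-- The assumption `(Θ-NPC1)`, which contains unique geodesicity. -/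
def ThetaNPC1 (Θ : ℝ≥0 → ℝ≥0) : Prop :=
  UniquelyGeodesic X ∧
  ∀ (x y x' y' : X) (γ γ' : I → X), IsGeodesic x y γ → IsGeodesic x' y' γ' → ∀ t : I,
    (Θ (nndist (γ t) (γ' t)) : ℝ) ≤
      (1 - (t : ℝ)) * Θ (nndist x x') + (t : ℝ) * Θ (nndist y y')

/-- If `[x, y] ∥ [x', y']`, then `[x, x'] ∥ [y, y']`. -/
def NPC2 : Prop :=
  ∀ x y x' y' : X, Parallel x y x' y' → Parallel x x' y y'

/-- If `[x, y] ∥ [y, z]`, then `[x, y] ∪ [y, z]` is a geodesic segment from `x` to `z`. -/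
def NPC3 : Prop :=
  ∀ x y z : X, Parallel x y y z →
    ∀ γ₁ γ₂ : I → X, IsGeodesic x y γ₁ → IsGeodesic y z γ₂ →
      ∃ γ : I → X, IsGeodesic x z γ ∧ Set.range γ = Set.range γ₁ ∪ Set.range γ₂

/-- `CAT(0)` spaces: geodesic spaces all of whose geodesic triangles are at least as thin as their
comparison triangles in the Euclidean plane. (Two points of a triangle on different sides lie on
two sides with a common vertex, called `a` here.) -/
def IsCAT0 : Prop :=
  (∀ x y : X, ∃ γ : I → X, IsGeodesic x y γ) ∧
  ∀ (a b c : X) (γ γ' : I → X), IsGeodesic a b γ → IsGeodesic a c γ' →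
    ∀ a' b' c' : EuclideanSpace ℝ (Fin 2),
      dist a' b' = dist a b → dist a' c' = dist a c → dist b' c' = dist b c →
      ∀ s t : I, dist (γ s) (γ' t) ≤
        dist (AffineMap.lineMap a' b' (s : ℝ)) (AffineMap.lineMap a' c' (t : ℝ))

/-- The metric space `X` is (the underlying metric space of) a Banach space. Complex Banach spaces
are included, as real ones. -/
def IsBanach : Prop :=
  ∃ (E : Type u) (_ : NormedAddCommGroup E) (_ : NormedSpace ℝ E),
    CompleteSpace E ∧ Nonempty (X ≃ᵢ E)

end Geodesics

/-! ### Pointed metric ultraproducts -/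

section Ultraproduct

variable (𝒰 : Ultrafilter ℕ) (X : ℕ → MSpace.{u}) (w : ∀ n, X n)

/-- Sequences `(x_n)` with `sup_n d(x_n, w_n) < ∞`. (The ultrafilter is a parameter because it
determines the pseudometric put on this type.) -/
@[nolint unusedArguments]
structure BoundedSeq (𝒰 : Ultrafilter ℕ) (X : ℕ → MSpace.{u}) (w : ∀ n, X n) : Type u where
  seq : ∀ n, X n
  bdd : BddAbove (Set.range fun n => dist (seq n) (w n))

variable {𝒰 X w}

/-- The limit along `𝒰` of the real numbers `d(x_n, y_n)`. -/
noncomputable def BoundedSeq.ulim (x y : BoundedSeq 𝒰 X w) : ℝ :=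
  Filter.limUnder (𝒰 : Filter ℕ) fun n => dist (x.seq n) (y.seq n)

theorem BoundedSeq.tendsto_ulim (x y : BoundedSeq 𝒰 X w) :
    Filter.Tendsto (fun n => dist (x.seq n) (y.seq n)) (𝒰 : Filter ℕ) (nhds (x.ulim y)) := by
  obtain ⟨A, hA⟩ := x.bdd
  obtain ⟨B, hB⟩ := y.bdd
  have hmem : ∀ n, dist (x.seq n) (y.seq n) ∈ Set.Icc (0 : ℝ) (A + B) := fun n =>
    ⟨dist_nonneg, (dist_triangle_right _ _ (w n)).trans
      (add_le_add (hA ⟨n, rfl⟩) (hB ⟨n, rfl⟩))⟩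
  have hle : ((𝒰.map fun n => dist (x.seq n) (y.seq n) : Ultrafilter ℝ) : Filter ℝ) ≤
      Filter.principal (Set.Icc (0 : ℝ) (A + B)) := by
    rw [Filter.le_principal_iff]
    exact Filter.mem_map.2 (Filter.univ_mem' hmem)
  obtain ⟨r, -, hr⟩ := isCompact_Icc.ultrafilter_le_nhds _ hle
  exact tendsto_nhds_limUnder ⟨r, hr⟩

noncomputable instance : PseudoMetricSpace (BoundedSeq 𝒰 X w) where
  dist := BoundedSeq.ulim
  dist_self x := tendsto_nhds_unique (x.tendsto_ulim x) (by simp)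
  dist_comm x y := tendsto_nhds_unique (x.tendsto_ulim y)
    (by simpa only [dist_comm] using y.tendsto_ulim x)
  dist_triangle x y z := le_of_tendsto_of_tendsto' (x.tendsto_ulim z)
    ((x.tendsto_ulim y).add (y.tendsto_ulim z)) fun _ => dist_triangle _ _ _

variable (𝒰 X w)

/-- The pointed metric ultraproduct of the pointed spaces `(X_n, w_n)` (without its base point):
the quotient of the bounded sequences by the relation "at distance zero", with the distance
`lim_𝒰 d(x_n, y_n)`. -/
abbrev MetricUltraproduct : Type u := SeparationQuotient (BoundedSeq 𝒰 X w)

end Ultraproduct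

/-! ### Assumptions on a class of metric spaces -/

/-- `(S₊)`: for `(X, d) ∈ 𝒳` and `r ≥ 1`, the space `(X, r d)` belongs to `𝒳` (up to isometry). -/
def StableScaleUp (𝒳 : Set MSpace.{u}) : Prop :=
  ∀ X ∈ 𝒳, ∀ r : ℝ, 1 ≤ r → ∃ Y ∈ 𝒳, ∃ e : X ≃ Y, ∀ x x' : X, dist (e x) (e x') = r * dist x x'

/-- `(U)`: for some non-principal ultrafilter on `ℕ`, all pointed metric ultraproducts of members
of `𝒳` belong to `𝒳` (up to isometry). -/
def StableUltraproduct (𝒳 : Set MSpace.{u}) : Prop :=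
  ∃ 𝒰 : Ultrafilter ℕ, (∀ n, 𝒰 ≠ pure n) ∧
    ∀ X : ℕ → MSpace.{u}, (∀ n, X n ∈ 𝒳) → ∀ w : ∀ n, X n,
      ∃ Y ∈ 𝒳, Nonempty (MetricUltraproduct 𝒰 X w ≃ᵢ Y)

/-! ### Fixed point properties and the game -/

section Groups

variable {G : Type v} [Group G]

/-- The fixed points of a subgroup `M` in an isometric action `α` of `G` on `X`. -/
def fixedSet {X : Type u} [MetricSpace X] (α : G →* (X ≃ᵢ X)) (M : Subgroup G) : Set X :=
  {x | ∀ h ∈ M, α h x = x}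

/-- Relative property `(F_𝒳)` for `G ≥ M`. -/
def RelPropertyF (𝒳 : Set MSpace.{u}) (M : Subgroup G) : Prop :=
  ∀ X ∈ 𝒳, ∀ α : G →* (X ≃ᵢ X), (fixedSet α M).Nonempty

variable (G) in
/-- Property `(F_𝒳)` for `G`. -/
def PropertyF (𝒳 : Set MSpace.{u}) : Prop :=
  RelPropertyF 𝒳 (⊤ : Subgroup G)

/-- The subset `Inn(G) · Φ` of `Aut(G)`. -/
def innMul (Φ : Subgroup (MulAut G)) : Set (MulAut G) :=
  {φ | ∃ g : G, ∃ ψ ∈ Φ, φ = MulAut.conj g * ψ}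

variable {l : ℕ}

/-- A move of type `(I⁺)`, indexed by a non-derangement `τ`, with the set `P`: it enlarges the
subgroups `H i` with `τ i = i` to `⟨H i, P⟩` and keeps the other ones. -/
def MoveIPlus (M : Fin l → Subgroup G) (P : Set G) (H H' : Fin l → Subgroup G) : Prop :=
  ∃ τ : Equiv.Perm (Fin l), τ ∉ derangements (Fin l) ∧
    (∀ h ∈ P, ∀ i, M (τ i) ≤ (H i).map (MulAut.conj h).toMonoidHom) ∧
    ∀ i, (τ i = i → H' i = H i ⊔ Subgroup.closure P) ∧ (τ i ≠ i → H' i = H i)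

/-- A move of type `(II)`, indexed by a permutation `τ`. -/
def MoveII (M : Fin l → Subgroup G) (Φ : Subgroup (MulAut G)) (H H' : Fin l → Subgroup G) : Prop :=
  ∃ (τ : Equiv.Perm (Fin l)) (Λ : Set (MulAut G)), Λ ⊆ innMul Φ ∧
    (∀ φ ∈ Λ, ∀ i, (M (τ i)).map φ.toMonoidHom ≤ H i) ∧
    ∀ i, H' i = H i ⊔ ⨆ φ ∈ Λ, (H (τ i)).map φ.toMonoidHom

/-- One move in the game `(Game_l⁺)`. -/
def StepPlus (M : Fin l → Subgroup G) (Φ : Subgroup (MulAut G)) (H H' : Fin l → Subgroup G) :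
    Prop :=
  (∃ P : Set G, MoveIPlus M P H H') ∨ MoveII M Φ H H'

/-- One move in the game `(Game_l)`: in moves of type `(I)` the abelianization of `⟨P⟩` has to be
a torsion group. -/
def Step (M : Fin l → Subgroup G) (Φ : Subgroup (MulAut G)) (H H' : Fin l → Subgroup G) : Prop :=
  (∃ P : Set G, IsMulTorsion (Abelianization (Subgroup.closure P)) ∧ MoveIPlus M P H H') ∨
    MoveII M Φ H H'

/-- `(GAME_l⁺)`: from the initial position `H = M`, finitely many moves of `(Game_l⁺)` lead to a
position with `H i = G` for some `i`. -/
def WinsGamePlus (M : Fin l → Subgroup G) (Φ : Subgroup (MulAut G)) : Prop :=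
  ∃ H : Fin l → Subgroup G, Relation.ReflTransGen (StepPlus M Φ) M H ∧ ∃ i, H i = ⊤

/-- `(GAME_l)`: from the initial position `H = M`, finitely many moves of `(Game_l)` lead to a
position with `H i = G` for some `i`. -/
def WinsGame (M : Fin l → Subgroup G) (Φ : Subgroup (MulAut G)) : Prop :=
  ∃ H : Fin l → Subgroup G, Relation.ReflTransGen (Step M Φ) M H ∧ ∃ i, H i = ⊤

end Groups

end Synthesis

/-!
Suppose that some action on a member of `𝒳` has no global fixed point. By Hofer's lemma there are
points near which the displacement function does not drop below half of its value; rescaling there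
and passing to an ultraproduct gives a *uniform* action, in which every point is moved by at least
`1` by some element of a fixed finite generating set `S` (`exists_isUniformAction`). Among all tuples
`(ξ i)` of fixed points of the `M i`, in all uniform actions on all members of `𝒳`, there is one of
least energy `∑ Θ (dist (ξ i) (ξ j)) ^ 2`, again by an ultraproduct (`exists_isMinConfig`).

The invariant of the game is that, in *every* such minimal configuration, `H i` fixes `ξ i`. Since
`S` may be chosen invariant under the finite group of automorphisms, a move of type (II) twists a
minimal configuration into another one (`FixesMinConfigs.moveII`). In a move of type (I), every
`h ∈ P` yields a second minimal configuration `(h ξ (τ⁻¹ i))` in the same action. Convexity forces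
the segments joining two minimal configurations to be mutually parallel
(`IsMinConfig.parallel`); as each `M j` fixes one of them and the `M j` generate `G`, their direction
is `G`-invariant. So for `τ i = i` the element `h` *translates* `ξ i` in a `G`-invariant direction
(`FixesMinConfigs.moveIPlus`), and it remains to see that translations are trivial. A winning
position then has a global fixed point in a uniform action, which is absurd.

* Translations of a point `x` form a group that acts on the orbit of `x` through its abelianization
  and without torsion, by `NPC2`, `NPC3` and `TP`. This settles the case of torsion abelianizations
  (`apply_eq_of_isMulTorsion`).
* In a `CAT(0)` space, a translation `h` moves `x` along a ray. Rays at bounded distance have the same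
  Busemann function up to a constant, so that all subgroups with a fixed point preserve the Busemann
  function, but `h` does not (`IsCAT0.apply_eq_of_mem_translations`).
* In a Banach space, stability under ultraproducts upgrades unique geodesicity to uniform convexity.
  A translation moves `x` by an invariant vector `v`, which is a finite sum of vectors `L y - y` with
  `L` the linear part of a group element. From the terms of this sum one builds a random walk by
  affine isometries that is centred and yet has linear drift `v` when run backwards; uniform
  convexity excludes this unless `v = 0` (`IsDriftingWalk.drift_eq_zero`).
-/

namespace Synthesis

/-! ### Geodesics -/

section Geodesics

variable {X : Type u} [MetricSpace X] {x y z x' y' x'' y'' : X}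

@[simp]
theorem coe_half : ((half : I) : ℝ) = 1 / 2 := rfl

@[simp]
theorem symm_half : σ half = half := by
  ext
  norm_num [half]

theorem isGeodesic_const (x : X) : IsGeodesic x x fun _ => x :=
  ⟨rfl, rfl, by simp⟩

theorem IsGeodesic.symm {γ : I → X} (h : IsGeodesic x y γ) :
    IsGeodesic y x fun t => γ (σ t) := by
  refine ⟨by simp [h.2.1], by simp [h.1], fun s t => ?_⟩
  rw [h.2.2, dist_comm x y, abs_sub_comm]
  simp

theorem IsGeodesic.map {γ : I → X} (h : IsGeodesic x y γ) {Y : Type*} [MetricSpace Y] {f : X → Y}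
    (hf : Isometry f) : IsGeodesic (f x) (f y) fun t => f (γ t) :=
  ⟨congrArg f h.1, congrArg f h.2.1, fun s t => by rw [hf.dist_eq, hf.dist_eq, h.2.2]⟩

theorem IsGeodesic.dist_left {γ : I → X} (h : IsGeodesic x y γ) (t : I) :
    dist x (γ t) = t * dist x y := by
  have := h.2.2 0 t
  rwa [h.1, Set.Icc.coe_zero, zero_sub, abs_neg, abs_of_nonneg t.2.1] at this

theorem IsGeodesic.dist_right {γ : I → X} (h : IsGeodesic x y γ) (t : I) :
    dist (γ t) y = (1 - t) * dist x y := by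
  have := h.2.2 t 1
  rwa [h.2.1, Set.Icc.coe_one, abs_sub_comm, abs_of_nonneg (sub_nonneg.2 t.2.2)] at this

/-- A path from `x` to `y` that is `dist x y`-Lipschitz is a geodesic: the total length leaves no
slack. -/
theorem IsGeodesic.of_dist_le {γ : I → X} (h0 : γ 0 = x) (h1 : γ 1 = y)
    (h : ∀ s t : I, s ≤ t → dist (γ s) (γ t) ≤ ((t : ℝ) - s) * dist x y) : IsGeodesic x y γ := by
  have key : ∀ s t : I, s ≤ t → dist (γ s) (γ t) = ((t : ℝ) - s) * dist x y := by
    intro s t hst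
    refine le_antisymm (h s t hst) ?_
    have a := h 0 s s.2.1
    have b := h t 1 t.2.2
    rw [h0] at a
    rw [h1] at b
    have c := dist_triangle4 x (γ s) (γ t) y
    simp only [Set.Icc.coe_zero, Set.Icc.coe_one] at a b
    nlinarith
  refine ⟨h0, h1, fun s t => ?_⟩
  rcases le_total s t with hst | hst
  · rw [key s t hst, abs_sub_comm, abs_of_nonneg (sub_nonneg.2 (Subtype.coe_le_coe.2 hst))]
  · rw [dist_comm, key t s hst, abs_of_nonneg (sub_nonneg.2 (Subtype.coe_le_coe.2 hst))]

/-- Two segments of equal length whose lengths add up form a geodesic. -/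
theorem exists_isGeodesic_through {γ₁ γ₂ : I → X} (h₁ : IsGeodesic x y γ₁)
    (h₂ : IsGeodesic y z γ₂) (hxy : dist x y = dist x z / 2) (hyz : dist y z = dist x z / 2) :
    ∃ γ : I → X, IsGeodesic x z γ ∧ γ half = y := by
  let a : ℝ → I := fun t => Set.projIcc 0 1 zero_le_one (2 * t)
  let b : ℝ → I := fun t => Set.projIcc 0 1 zero_le_one (2 * t - 1)
  have ha : ∀ t : I, (t : ℝ) ≤ 1 / 2 → (a t : ℝ) = 2 * t := fun t ht => by
    have := t.2.1
    simp only [a, Set.coe_projIcc]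
    rw [min_eq_right (by linarith), max_eq_right (by linarith)]
  have hb : ∀ t : I, ¬ (t : ℝ) ≤ 1 / 2 → (b t : ℝ) = 2 * t - 1 := fun t ht => by
    have := t.2.2
    simp only [b, Set.coe_projIcc]
    rw [min_eq_right (by linarith), max_eq_right (by linarith)]
  refine ⟨fun t => if (t : ℝ) ≤ 1 / 2 then γ₁ (a t) else γ₂ (b t),
    IsGeodesic.of_dist_le ?_ ?_ ?_, ?_⟩
  · have : a (0 : I) = 0 := Subtype.ext (by rw [ha] <;> simp)
    simp only [this, h₁.1]
    norm_num
  · have : b (1 : I) = 1 := Subtype.ext (by rw [hb] <;> norm_num)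
    simp only [this, h₂.2.1]
    norm_num
  · intro s t hst
    have hst' : (s : ℝ) ≤ t := hst
    by_cases ht : (t : ℝ) ≤ 1 / 2
    · rw [if_pos ht, if_pos (hst'.trans ht), h₁.2.2, ha t ht, ha s (hst'.trans ht), hxy,
        abs_sub_comm, abs_of_nonneg (by linarith)]
      linarith
    · rw [if_neg ht]
      by_cases hs : (s : ℝ) ≤ 1 / 2
      · rw [if_pos hs]
        refine (dist_triangle _ y _).trans ?_
        rw [h₁.dist_right, h₂.dist_left, ha s hs, hb t ht, hxy, hyz]
        linarith
      · rw [if_neg hs, h₂.2.2, hb t ht, hb s hs, hyz, abs_sub_comm, abs_of_nonneg (by linarith)]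
        linarith
  · have : a (half : I) = 1 := Subtype.ext (by rw [ha] <;> simp)
    rw [coe_half] at this
    simp only [coe_half, le_refl, if_true, this, h₁.2.1]

theorem UniquelyGeodesic.eq_of_midpoint (hX : UniquelyGeodesic X) (hxy : dist x y = dist x z / 2)
    (hyz : dist y z = dist x z / 2) (hxy' : dist x y' = dist x z / 2)
    (hyz' : dist y' z = dist x z / 2) : y = y' := by
  obtain ⟨γ, hγ, h⟩ := exists_isGeodesic_through (hX x y).choose_spec.1 (hX y z).choose_spec.1
    hxy hyz
  obtain ⟨γ', hγ', h'⟩ := exists_isGeodesic_through (hX x y').choose_spec.1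
    (hX y' z).choose_spec.1 hxy' hyz'
  rw [← h, ← h', (hX x z).unique hγ hγ']

theorem UniquelyGeodesic.of_isometryEquiv {Y : Type*} [MetricSpace Y] (hX : UniquelyGeodesic X)
    (e : X ≃ᵢ Y) : UniquelyGeodesic Y := by
  intro x y
  obtain ⟨γ, hγ, huniq⟩ := hX (e.symm x) (e.symm y)
  refine ⟨fun t => e (γ t), by simpa using hγ.map e.isometry, fun γ' hγ' => ?_⟩
  funext t
  rw [← huniq _ (hγ'.map e.symm.isometry)]
  simp

/-! ### Parallelism -/

theorem Parallel.symm (h : Parallel x y x' y') : Parallel x' y' x y := by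
  obtain ⟨γ, γ', hγ, hγ', h1, h2⟩ := h
  exact ⟨γ', γ, hγ', hγ, by rw [dist_comm, h1, dist_comm], by rw [dist_comm, h2, dist_comm]⟩

/-- Reversing the orientation of two parallel segments. -/
theorem Parallel.reverse (h : Parallel x y x' y') : Parallel y x y' x' := by
  obtain ⟨γ, γ', hγ, hγ', h1, h2⟩ := h
  exact ⟨_, _, hγ.symm, hγ'.symm, h1.symm, by simp only [symm_half, h1, h2]⟩

theorem Parallel.map (h : Parallel x y x' y') {Y : Type*} [MetricSpace Y] {f : X → Y}
    (hf : Isometry f) : Parallel (f x) (f y) (f x') (f y') := by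
  obtain ⟨γ, γ', hγ, hγ', h1, h2⟩ := h
  exact ⟨_, _, hγ.map hf, hγ'.map hf, by simp only [hf.dist_eq, h1],
    by simp only [hf.dist_eq, h2]⟩

theorem Parallel.dist_eq (h : Parallel x y x' y') : dist x x' = dist y y' := by
  obtain ⟨γ, γ', hγ, hγ', h1, h2⟩ := h
  exact h1

theorem UniquelyGeodesic.parallel_refl (hX : UniquelyGeodesic X) (x y : X) : Parallel x y x y :=
  ⟨_, _, (hX x y).choose_spec.1, (hX x y).choose_spec.1, by simp, by simp⟩

theorem parallel_const (x y : X) : Parallel x x y y :=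
  ⟨_, _, isGeodesic_const x, isGeodesic_const y, rfl, rfl⟩

theorem NPC3.dist_eq_two_mul (hX : NPC3 X) (h : Parallel x y y z) : dist x z = 2 * dist x y := by
  obtain ⟨γ₁, γ₂, h₁, h₂, h3, -⟩ := id h
  obtain ⟨γ, hγ, hr⟩ := hX x y z h γ₁ γ₂ h₁ h₂
  obtain ⟨t, rfl⟩ : y ∈ Set.range γ := hr ▸ Or.inl ⟨1, h₁.2.1⟩
  have a := hγ.dist_left t
  have b := hγ.dist_right t
  linarith

end Geodesics

/-! ### Elements of a group that translate a point -/

section Translations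

variable {G : Type v} [Group G] {X : Type u} [MetricSpace X]

/-- The stabilizer of a point under an isometric action. -/
def pointStabilizer (α : G →* (X ≃ᵢ X)) (x : X) : Subgroup G where
  carrier := {g | α g x = x}
  one_mem' := by simp
  mul_mem' {a b} ha hb := by
    simp only [Set.mem_ofPred_eq, map_mul, IsometryEquiv.mul_apply] at *
    rw [hb, ha]
  inv_mem' {a} ha := by
    simp only [Set.mem_ofPred_eq, map_inv] at *
    conv_lhs => rw [← ha]
    exact IsometryEquiv.inv_apply_self _ _

/-- The elements `h` that translate `x` in a `G`-invariant direction: all translates by `G` of the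
oriented segment `[x, h x]` are parallel to it. -/
def translations (h2 : NPC2 X) (hT : TP X) (α : G →* (X ≃ᵢ X)) (x : X) :
    Subgroup G where
  carrier := {h | ∀ g, Parallel (α g x) (α (g * h) x) x (α h x)}
  one_mem' g := by
    simpa using parallel_const (α g x) x
  inv_mem' {h} hh g := by
    have a := hh (g * h⁻¹)
    have b := hh h⁻¹
    simp only [inv_mul_cancel_right, inv_mul_cancel, map_one, IsometryEquiv.coe_one, id] at a b
    exact (hT _ _ _ _ _ _ a b.symm).reverse
  mul_mem' {h k} hh hk g := by
    have a := hT _ _ _ _ _ _ (hk (g * h)) (hk h).symm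
    have b := hT _ _ _ _ _ _ (h2 _ _ _ _ (hh g)) (h2 _ _ _ _ a)
    rw [← mul_assoc]
    exact h2 _ _ _ _ b

variable {h2 : NPC2 X} {hT : TP X} {α : G →* (X ≃ᵢ X)} {x : X} {h k : G}

/-- Translations commute at the translated point: both `[h x, k h x]` and `[h x, h k x]` are
parallel to `[x, k x]`. -/
theorem apply_mul_comm_of_mem_translations (hh : h ∈ translations h2 hT α x)
    (hk : k ∈ translations h2 hT α x) : α (h * k) x = α (k * h) x := by
  have a := h2 _ _ _ _ (hh k).reverse
  have b := hT _ _ _ _ _ _ (hk h) (h2 _ _ _ _ (hh k).symm)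
  simpa [eq_comm] using b.dist_eq

/-- The stabilizer of `x` contains the derived subgroup of any group of translations of `x`. -/
theorem commutator_apply_of_le_translations {Γ : Subgroup G}
    (hΓ : Γ ≤ translations h2 hT α x) {c : Γ} (hc : c ∈ commutator Γ) : α c x = x := by
  suffices commutator Γ ≤ (pointStabilizer α x).subgroupOf Γ from this hc
  rw [commutator_def, Subgroup.commutator_le]
  intro a _ b _
  have := apply_mul_comm_of_mem_translations (hΓ a⁻¹.2) (hΓ b⁻¹.2)
  have e : Γ.subtype (a * b * a⁻¹ * b⁻¹) = (a * b : G) * ((a⁻¹ : Γ) * (b⁻¹ : Γ) : G) := by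
    simp [mul_assoc]
  change α (Γ.subtype (a * b * a⁻¹ * b⁻¹)) x = x
  rw [e, map_mul, IsometryEquiv.mul_apply, this, ← IsometryEquiv.mul_apply, ← map_mul]
  simp

theorem dist_pow_two_pow_of_mem_translations (h3 : NPC3 X)
    (hh : h ∈ translations h2 hT α x) (n : ℕ) :
    dist x (α (h ^ 2 ^ n) x) = 2 ^ n * dist x (α h x) := by
  induction n with
  | zero => simp
  | succ n ih =>
    have a := (pow_mem hh (2 ^ n)) (h ^ 2 ^ n)
    have b := h3.dist_eq_two_mul a.symm
    rw [← pow_add] at b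
    rw [pow_succ, mul_two, b, ih]
    ring

theorem dist_pow_le (α : G →* (X ≃ᵢ X)) (x : X) (h : G) (n : ℕ) :
    dist x (α (h ^ n) x) ≤ n * dist x (α h x) := by
  induction n with
  | zero => simp
  | succ n ih =>
    have : dist (α h x) (α (h ^ (n + 1)) x) = dist x (α (h ^ n) x) := by
      rw [pow_succ', map_mul, IsometryEquiv.mul_apply, IsometryEquiv.dist_eq]
    have := dist_triangle x (α h x) (α (h ^ (n + 1)) x)
    push_cast
    linarith

/-- The orbit of `x` under the powers of a translation runs along a geodesic ray. -/
theorem dist_pow_of_mem_translations (h3 : NPC3 X) (hh : h ∈ translations h2 hT α x) (n : ℕ) :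
    dist x (α (h ^ n) x) = n * dist x (α h x) := by
  refine le_antisymm (dist_pow_le α x h n) ?_
  obtain ⟨m, hm⟩ := Nat.exists_eq_add_of_le (Nat.lt_two_pow_self (n := n)).le
  have a := dist_pow_two_pow_of_mem_translations h3 hh n
  have b := dist_pow_le α x h m
  have c : dist (α (h ^ n) x) (α (h ^ 2 ^ n) x) = dist x (α (h ^ m) x) := by
    rw [hm, pow_add, map_mul, IsometryEquiv.mul_apply, IsometryEquiv.dist_eq]
  have e := dist_triangle x (α (h ^ n) x) (α (h ^ 2 ^ n) x)
  have f : (2 ^ n : ℝ) = n + m := by exact_mod_cast hm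
  rw [f] at a
  linarith

/-- A translation some non-trivial power of which fixes `x` fixes `x`. -/
theorem apply_eq_of_pow_apply_eq (h3 : NPC3 X) (hh : h ∈ translations h2 hT α x) {n : ℕ}
    (hn : 0 < n) (hx : α (h ^ n) x = x) : α h x = x := by
  have := dist_pow_of_mem_translations h3 hh n
  rw [hx, dist_self, zero_eq_mul, Nat.cast_eq_zero] at this
  exact (dist_eq_zero.1 (this.resolve_left hn.ne')).symm

/-- A group of translations of `x` with torsion abelianization fixes `x`. -/
theorem apply_eq_of_isMulTorsion (h3 : NPC3 X) {Γ : Subgroup G}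
    (hΓ : Γ ≤ translations h2 hT α x) (htors : IsMulTorsion (Abelianization Γ)) (hh : h ∈ Γ) :
    α h x = x := by
  obtain ⟨n, hn, hpow⟩ := isOfFinOrder_iff_pow_eq_one.1
    (htors (Abelianization.of (⟨h, hh⟩ : Γ)))
  rw [← map_pow] at hpow
  have hc : (⟨h, hh⟩ : Γ) ^ n ∈ commutator Γ := by
    rw [← Abelianization.ker_of]
    exact hpow
  exact apply_eq_of_pow_apply_eq h3 (hΓ hh) hn (commutator_apply_of_le_translations hΓ hc)

end Translations

/-! ### Actions on pointed metric ultraproducts -/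

section Ultraproducts

variable {G : Type v} [Group G]

open Filter Topology

theorem exists_monoidHom_of_isometry {Y : Type u} [MetricSpace Y] (f : G → Y → Y)
    (h_one : ∀ y, f 1 y = y) (h_mul : ∀ g h y, f (g * h) y = f g (f h y))
    (h_isom : ∀ g, Isometry (f g)) : ∃ β : G →* (Y ≃ᵢ Y), ∀ g y, β g y = f g y := by
  refine ⟨{ toFun := fun g => IsometryEquiv.mk' (f g) (f g⁻¹) (fun y => ?_) (h_isom g),
            map_one' := ?_, map_mul' := ?_ }, fun g y => rfl⟩
  · rw [← h_mul, mul_inv_cancel, h_one]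
  · ext y
    exact h_one y
  · intro g h
    ext y
    exact h_mul g h y

/-- Rescaling an action on a member of a class with `(S₊)`. -/
theorem StableScaleUp.exists_action {𝒳 : Set MSpace.{u}} (hS : StableScaleUp 𝒳) {X : MSpace.{u}}
    (hX : X ∈ 𝒳) (α : G →* (X ≃ᵢ X)) {r : ℝ} (hr : 1 ≤ r) :
    ∃ Y ∈ 𝒳, ∃ (β : G →* (Y ≃ᵢ Y)) (e : X ≃ Y),
      (∀ x x', dist (e x) (e x') = r * dist x x') ∧ ∀ g x, β g (e x) = e (α g x) := by
  obtain ⟨Y, hY, e, he⟩ := hS X hX r hr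
  obtain ⟨β, hβ⟩ := exists_monoidHom_of_isometry (fun g y => e (α g (e.symm y))) (by simp)
    (by simp) fun g => Isometry.of_dist_eq fun y y' => by
      rw [he, IsometryEquiv.dist_eq, ← he, e.apply_symm_apply, e.apply_symm_apply]
  exact ⟨Y, hY, β, e, he, fun g x => by simp [hβ]⟩

/-- Points of a pointed metric ultraproduct. The map `π` sends a bounded sequence to the point it
represents. -/
theorem exists_ultraproduct {𝒳 : Set MSpace.{u}} {𝒰 : Ultrafilter ℕ}
    (h𝒰 : ∀ X : ℕ → MSpace.{u}, (∀ n, X n ∈ 𝒳) → ∀ w : ∀ n, X n,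
      ∃ Y ∈ 𝒳, Nonempty (MetricUltraproduct 𝒰 X w ≃ᵢ Y))
    {X : ℕ → MSpace.{u}} (hX : ∀ n, X n ∈ 𝒳) (w : ∀ n, X n) :
    ∃ Y ∈ 𝒳, ∃ π : BoundedSeq 𝒰 X w → Y, Function.Surjective π ∧
      ∀ x y, Tendsto (fun n => dist (x.seq n) (y.seq n)) 𝒰 (𝓝 (dist (π x) (π y))) := by
  obtain ⟨Y, hY, ⟨e⟩⟩ := h𝒰 X hX w
  refine ⟨Y, hY, fun x => e (SeparationQuotient.mk x),
    e.surjective.comp SeparationQuotient.surjective_mk, fun x y => ?_⟩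
  rw [e.dist_eq, SeparationQuotient.dist_mk]
  exact x.tendsto_ulim y

/-- Applying isometries, with bounded displacement of the base points, to a bounded sequence. -/
def BoundedSeq.map {𝒰 : Ultrafilter ℕ} {X : ℕ → MSpace.{u}} {w : ∀ n, X n} (f : ∀ n, X n ≃ᵢ X n)
    (hf : BddAbove (Set.range fun n => dist (f n (w n)) (w n))) (x : BoundedSeq 𝒰 X w) :
    BoundedSeq 𝒰 X w where
  seq n := f n (x.seq n)
  bdd := by
    obtain ⟨A, hA⟩ := x.bdd
    obtain ⟨B, hB⟩ := hf
    refine ⟨A + B, ?_⟩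
    rintro _ ⟨n, rfl⟩
    refine (dist_triangle _ (f n (w n)) _).trans (add_le_add ?_ (hB ⟨n, rfl⟩))
    rw [IsometryEquiv.dist_eq]
    exact hA ⟨n, rfl⟩

/-- Actions with bounded displacement of the base points induce an action on the pointed metric
ultraproduct. -/
theorem exists_ultraproduct_action {𝒳 : Set MSpace.{u}} {𝒰 : Ultrafilter ℕ}
    (h𝒰 : ∀ X : ℕ → MSpace.{u}, (∀ n, X n ∈ 𝒳) → ∀ w : ∀ n, X n,
      ∃ Y ∈ 𝒳, Nonempty (MetricUltraproduct 𝒰 X w ≃ᵢ Y))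
    {X : ℕ → MSpace.{u}} (hX : ∀ n, X n ∈ 𝒳) (w : ∀ n, X n) (α : ∀ n, G →* (X n ≃ᵢ X n))
    (hw : ∀ g, BddAbove (Set.range fun n => dist (α n g (w n)) (w n))) :
    ∃ Y ∈ 𝒳, ∃ (β : G →* (Y ≃ᵢ Y)) (π : BoundedSeq 𝒰 X w → Y), Function.Surjective π ∧
      (∀ x y, Tendsto (fun n => dist (x.seq n) (y.seq n)) 𝒰 (𝓝 (dist (π x) (π y)))) ∧
      ∀ g x y, (∀ n, y.seq n = α n g (x.seq n)) → β g (π x) = π y := by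
  obtain ⟨Y, hY, π, hπ, hdist⟩ := exists_ultraproduct h𝒰 hX w
  let act : G → BoundedSeq 𝒰 X w → BoundedSeq 𝒰 X w := fun g => BoundedSeq.map (α · g) (hw g)
  have hact : ∀ g x y, dist (π (act g x)) (π (act g y)) = dist (π x) (π y) := fun g x y =>
    tendsto_nhds_unique (hdist _ _)
      ((hdist x y).congr fun n => ((α n g).dist_eq (x.seq n) (y.seq n)).symm)
  have hsurj : ∀ g x, π (act g (Function.surjInv hπ (π x))) = π (act g x) := fun g x => by
    rw [← dist_eq_zero, hact, Function.surjInv_eq hπ, dist_self]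
  obtain ⟨β, hβ⟩ := exists_monoidHom_of_isometry
    (fun g y => π (act g (Function.surjInv hπ y)))
    (fun y => by
      obtain ⟨x, rfl⟩ := hπ y
      rw [hsurj]
      simp [act, BoundedSeq.map])
    (fun g h y => by
      obtain ⟨x, rfl⟩ := hπ y
      rw [hsurj, hsurj h, hsurj]
      simp [act, BoundedSeq.map])
    (fun g => Isometry.of_dist_eq fun y y' => by
      rw [hact, Function.surjInv_eq hπ, Function.surjInv_eq hπ])
  refine ⟨Y, hY, β, π, hπ, hdist, ?_⟩
  rintro g x ⟨y, hy⟩ hxy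
  obtain rfl : y = fun n => α n g (x.seq n) := funext hxy
  rw [hβ, hsurj]
  rfl

/-- It is enough to bound the displacement of the base points by generators. -/
theorem bddAbove_displacement {X : ℕ → MSpace.{u}} (w : ∀ n, X n) (α : ∀ n, G →* (X n ≃ᵢ X n))
    {S : Set G} (hS : Subgroup.closure S = ⊤)
    (hw : ∀ g ∈ S, BddAbove (Set.range fun n => dist (α n g (w n)) (w n))) (g : G) :
    BddAbove (Set.range fun n => dist (α n g (w n)) (w n)) := by
  have hg : g ∈ Subgroup.closure S := hS ▸ Subgroup.mem_top g
  induction hg using Subgroup.closure_induction with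
  | mem g hg => exact hw g hg
  | one => exact ⟨0, by rintro _ ⟨n, rfl⟩; simp⟩
  | mul g h _ _ ihg ihh =>
    obtain ⟨A, hA⟩ := ihg
    obtain ⟨B, hB⟩ := ihh
    refine ⟨B + A, ?_⟩
    rintro _ ⟨n, rfl⟩
    refine (dist_triangle _ (α n g (w n)) _).trans (add_le_add ?_ (hA ⟨n, rfl⟩))
    rw [map_mul, IsometryEquiv.mul_apply, IsometryEquiv.dist_eq]
    exact hB ⟨n, rfl⟩
  | inv g _ ih =>
    obtain ⟨A, hA⟩ := ih
    refine ⟨A, ?_⟩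
    rintro _ ⟨n, rfl⟩
    have : dist (α n g⁻¹ (w n)) (w n) = dist (α n g (w n)) (w n) := by
      rw [← (α n g).dist_eq, ← IsometryEquiv.mul_apply, ← map_mul, dist_comm]
      simp
    simp only [this]
    exact hA ⟨n, rfl⟩

/-! ### Uniform actions -/

/-- An action is uniform with respect to `S` if every point is moved by a distance at least `1` by
some element of `S`. -/
def IsUniformAction (S : Finset G) {X : Type u} [MetricSpace X] (α : G →* (X ≃ᵢ X)) : Prop :=
  ∀ x, ∃ s ∈ S, 1 ≤ dist x (α s x)

theorem ultrafilter_le_atTop {𝒰 : Ultrafilter ℕ} (h : ∀ n, 𝒰 ≠ pure n) : (𝒰 : Filter ℕ) ≤ atTop :=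
  Nat.cofinite_eq_atTop ▸ 𝒰.le_cofinite_or_eq_pure.resolve_right fun ⟨n, hn⟩ => h n hn

/-- Uniformity passes to the ultraproduct, if along each bounded sequence it holds eventually. -/
theorem isUniformAction_of_ultraproduct {𝒰 : Ultrafilter ℕ} {X : ℕ → MSpace.{u}} {w : ∀ n, X n}
    {α : ∀ n, G →* (X n ≃ᵢ X n)} {S : Finset G} {Y : Type u} [MetricSpace Y]
    {β : G →* (Y ≃ᵢ Y)} {π : BoundedSeq 𝒰 X w → Y} (hπ : Function.Surjective π)
    (hdist : ∀ x y, Tendsto (fun n => dist (x.seq n) (y.seq n)) 𝒰 (𝓝 (dist (π x) (π y))))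
    (hβ : ∀ g x y, (∀ n, y.seq n = α n g (x.seq n)) → β g (π x) = π y)
    (hw : ∀ g, BddAbove (Set.range fun n => dist (α n g (w n)) (w n)))
    (h : ∀ x : BoundedSeq 𝒰 X w,
      ∀ᶠ n in 𝒰, ∃ s ∈ S, 1 ≤ dist (x.seq n) (α n s (x.seq n))) : IsUniformAction S β := by
  intro y
  obtain ⟨x, rfl⟩ := hπ y
  obtain ⟨s, hs, hev⟩ : ∃ s ∈ S, ∀ᶠ n in 𝒰, 1 ≤ dist (x.seq n) (α n s (x.seq n)) := by
    exact (Ultrafilter.eventually_exists_mem_iff (Finset.finite_toSet S)).1 (h x)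
  refine ⟨s, hs, ?_⟩
  rw [hβ s x (x.map (α · s) (hw s)) fun n => rfl]
  exact ge_of_tendsto (hdist _ _) hev

/-- If some action on a member of `𝒳` has no fixed point, then some action on a member of `𝒳` is
uniform. Hofer's lemma, applied to the inverse of the displacement, yields points `x n` such that
the displacement on a ball of radius `n * disp (x n)` around `x n` is at least half the displacement
of `x n`; rescale so that the latter becomes `2` and pass to the ultraproduct. -/
theorem exists_isUniformAction {𝒳 : Set MSpace.{u}} (hS : StableScaleUp 𝒳)
    (hU : StableUltraproduct 𝒳) {X : MSpace.{u}} (hX : X ∈ 𝒳) (α : G →* (X ≃ᵢ X))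
    (hα : ¬ (fixedSet α ⊤).Nonempty) {S : Finset G} (hgen : Subgroup.closure (S : Set G) = ⊤) :
    ∃ Y ∈ 𝒳, ∃ β : G →* (Y ≃ᵢ Y), IsUniformAction S β := by
  let disp : X → ℝ≥0 := fun x => S.sup fun s => nndist x (α s x)
  have hcont : Continuous fun x => (disp x : ℝ) := by
    refine NNReal.continuous_coe.comp ?_
    refine Continuous.finset_sup_apply fun s _ => ?_
    exact continuous_id.nndist (α s).continuous
  have hle : ∀ x, ∀ s ∈ S, dist x (α s x) ≤ disp x := fun x s hs => by
    rw [← coe_nndist, NNReal.coe_le_coe]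
    exact Finset.le_sup (f := fun s => nndist x (α s x)) hs
  have hpos : ∀ x, 0 < (disp x : ℝ) := by
    intro x
    by_contra hx
    refine hα ⟨x, fun g _ => ?_⟩
    have hg : g ∈ Subgroup.closure (S : Set G) := hgen ▸ Subgroup.mem_top g
    have : Subgroup.closure (S : Set G) ≤ pointStabilizer α x := by
      rw [Subgroup.closure_le]
      intro s hs
      exact (dist_le_zero.1 ((hle x s hs).trans (not_lt.1 hx))).symm
    exact this hg
  have hex : ∀ x (c : ℝ), 0 < c → c ≤ disp x → ∃ s ∈ S, c ≤ dist x (α s x) := by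
    intro x c hc hcx
    lift c to ℝ≥0 using hc.le
    obtain ⟨s, hs, h⟩ := (Finset.le_sup_iff (show (⊥ : ℝ≥0) < c from NNReal.coe_pos.1 hc)).1
      (NNReal.coe_le_coe.1 hcx)
    exact ⟨s, hs, by rw [← coe_nndist]; exact_mod_cast h⟩
  by_cases hone : ∀ x, (1 : ℝ) ≤ disp x
  · exact ⟨X, hX, α, fun x => hex x 1 one_pos (hone x)⟩
  push Not at hone
  obtain ⟨x₀, hx₀⟩ := hone
  have hofer' : ∀ n : ℕ, ∃ x, (disp x : ℝ) ≤ 1 ∧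
      ∀ y, dist x y ≤ n * disp x → disp x ≤ 2 * (disp y : ℝ) := by
    intro n
    obtain ⟨ε, hε, x, hεle, -, h1, h2⟩ := hofer x₀ ((n + 1) * disp x₀)
      (mul_pos n.cast_add_one_pos (hpos x₀)) (ϕ := fun x => (disp x : ℝ)⁻¹)
      (hcont.inv₀ fun x => (hpos x).ne') fun x => inv_nonneg.2 (hpos x).le
    have hx := hpos x
    rw [mul_assoc, mul_inv_cancel₀ (hpos x₀).ne', mul_one, ← div_eq_mul_inv, le_div_iff₀ hx] at h1
    refine ⟨x, ?_, fun y hy => ?_⟩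
    · have : (n + 1) * (disp x : ℝ) ≤ (n + 1) * disp x₀ := h1.trans hεle
      exact (le_of_mul_le_mul_left this n.cast_add_one_pos).trans hx₀.le
    · have h3 := h2 y (hy.trans (le_trans (by nlinarith) h1))
      rw [inv_le_iff_one_le_mul₀ (hpos y), mul_right_comm, ← div_eq_mul_inv, one_le_div hx] at h3
      exact h3
  -- The rescaled action moves `x n` by at most `2`, and all points at distance at most `2 * n` from
  -- it by at least `1`. As `disp (x n) ≤ 1`, the scaling factor is at least `1`.
  choose x hx1 hx2 using hofer'
  have hr : ∀ n, 1 ≤ 2 / (disp (x n) : ℝ) := fun n => by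
    rw [one_le_div (hpos _)]
    linarith [hx1 n]
  choose Y hY β e he hβ using fun n => hS.exists_action hX α (hr n)
  have hw := bddAbove_displacement (fun n => e n (x n)) β hgen fun s hs => by
    refine ⟨2, ?_⟩
    rintro _ ⟨n, rfl⟩
    simp only [hβ, he]
    rw [dist_comm, div_mul_eq_mul_div, div_le_iff₀ (hpos _)]
    exact mul_le_mul_of_nonneg_left (hle _ s hs) zero_le_two
  obtain ⟨𝒰, hne, h𝒰⟩ := hU
  obtain ⟨Z, hZ, γ, π, hπ, hd, hγ⟩ := exists_ultraproduct_action h𝒰 hY (fun n => e n (x n)) β hw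
  refine ⟨Z, hZ, γ, isUniformAction_of_ultraproduct hπ hd hγ hw fun z => ?_⟩
  obtain ⟨A, hA⟩ := z.bdd
  obtain ⟨N, hN⟩ := exists_nat_ge A
  filter_upwards [ultrafilter_le_atTop hne (Ici_mem_atTop N)] with n hn
  obtain ⟨y, hy⟩ := (e n).surjective (z.seq n)
  have hyx : dist (x n) y ≤ n * disp (x n) := by
    have h1 : dist (z.seq n) (e n (x n)) ≤ A := hA ⟨n, rfl⟩
    have h2 : (N : ℝ) ≤ n := Nat.cast_le.2 hn
    rw [← hy, he, dist_comm, div_mul_eq_mul_div, div_le_iff₀ (hpos _)] at h1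
    have := hpos (x n)
    have := mul_le_mul_of_nonneg_right (hN.trans h2) this.le
    linarith [dist_nonneg (x := x n) (y := y)]
  obtain ⟨s, hs, h⟩ := hex y (disp (x n) / 2) (by linarith [hpos (x n)])
    (by linarith [hx2 n y hyx])
  refine ⟨s, hs, ?_⟩
  rw [← hy, hβ, he, div_mul_eq_mul_div, one_le_div (hpos _)]
  linarith

/-- A finite generating set may be enlarged so as to be invariant under a finite group of
automorphisms. -/
theorem exists_finset_closure_eq_top [Group.FG G] (Φ : Subgroup (MulAut G)) [Finite Φ] :
    ∃ S : Finset G, Subgroup.closure (S : Set G) = ⊤ ∧ ∀ φ ∈ Φ, ∀ s ∈ S, φ s ∈ S := by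
  classical
  obtain ⟨S₀, hS₀⟩ := Group.fg_def.1 ‹Group.FG G›
  have := Fintype.ofFinite Φ
  refine ⟨Finset.univ.biUnion fun φ : Φ => S₀.image fun s => (φ : MulAut G) s, ?_, ?_⟩
  · rw [eq_top_iff, ← hS₀]
    refine Subgroup.closure_mono fun s hs => ?_
    simp only [Finset.coe_biUnion, Finset.mem_coe, Set.mem_iUnion, Finset.mem_image]
    exact ⟨1, Finset.mem_univ _, s, hs, rfl⟩
  · intro φ hφ s hs
    simp only [Finset.mem_biUnion, Finset.mem_image] at hs ⊢
    obtain ⟨ψ, -, s, hs, rfl⟩ := hs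
    exact ⟨⟨φ, hφ⟩ * ψ, Finset.mem_univ _, s, hs, rfl⟩

/-- If `S` is invariant under `Φ`, then uniformity with respect to `S` is invariant under twisting
the action by elements of `Inn(G) · Φ`. -/
theorem IsUniformAction.comp_innMul {S : Finset G} {Φ : Subgroup (MulAut G)}
    (hS : ∀ φ ∈ Φ, ∀ s ∈ S, φ s ∈ S) {X : Type u} [MetricSpace X] {α : G →* (X ≃ᵢ X)}
    (hα : IsUniformAction S α) {φ : MulAut G} (hφ : φ ∈ innMul Φ) :
    IsUniformAction S (α.comp φ.toMonoidHom) := by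
  obtain ⟨g, ψ, hψ, rfl⟩ := hφ
  intro x
  obtain ⟨s, hs, h⟩ := hα (α g⁻¹ x)
  refine ⟨ψ⁻¹ s, hS _ (inv_mem hψ) s hs, h.trans_eq ?_⟩
  rw [← (α g).dist_eq]
  simp [MulAut.conj_apply]

end Ultraproducts

/-! ### Minimal configurations of fixed points -/

section Configurations

open Filter Topology

variable {G : Type v} [Group G] {ι : Type*} [Fintype ι]

/-- The energy of a tuple of points: the sum of the squares of `Θ` of the mutual distances. The
squares have the effect that equality in the convexity estimate for the energy forces all distances
in two configurations to agree. -/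
noncomputable def energy (Θ : ℝ≥0 → ℝ≥0) {X : Type u} [MetricSpace X] (ξ : ι → X) : ℝ :=
  ∑ p : ι × ι, (Θ (nndist (ξ p.1) (ξ p.2)) : ℝ) ^ 2

/-- A tuple of fixed points of the `M i` in a uniform action on a member of `𝒳`. -/
structure IsConfig (𝒳 : Set MSpace.{u}) (S : Finset G) (M : ι → Subgroup G) (X : MSpace.{u})
    (α : G →* (X ≃ᵢ X)) (ξ : ι → X) : Prop where
  mem : X ∈ 𝒳
  uniform : IsUniformAction S α
  fixed : ∀ i, ξ i ∈ fixedSet α (M i)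

/-- A configuration of least energy, among those in all uniform actions on all members of `𝒳`. -/
structure IsMinConfig (Θ : ℝ≥0 → ℝ≥0) (𝒳 : Set MSpace.{u}) (S : Finset G) (M : ι → Subgroup G)
    (X : MSpace.{u}) (α : G →* (X ≃ᵢ X)) (ξ : ι → X) : Prop extends IsConfig 𝒳 S M X α ξ where
  energy_le : ∀ (X' : MSpace.{u}) (α' : G →* (X' ≃ᵢ X')) (ξ' : ι → X'),
    IsConfig 𝒳 S M X' α' ξ' → energy Θ ξ ≤ energy Θ ξ'

variable {Θ : ℝ≥0 → ℝ≥0} {𝒳 : Set MSpace.{u}} {S : Finset G} {M : ι → Subgroup G}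

theorem le_energy {X : Type u} [MetricSpace X] (ξ : ι → X) (i j : ι) :
    (Θ (nndist (ξ i) (ξ j)) : ℝ) ^ 2 ≤ energy Θ ξ :=
  Finset.single_le_sum (f := fun p : ι × ι => (Θ (nndist (ξ p.1) (ξ p.2)) : ℝ) ^ 2)
    (fun _ _ => sq_nonneg _) (Finset.mem_univ (i, j))

theorem energy_nonneg {X : Type u} [MetricSpace X] (ξ : ι → X) : 0 ≤ energy Θ ξ :=
  Finset.sum_nonneg fun _ _ => sq_nonneg _

theorem energy_comp_perm {X : Type u} [MetricSpace X] (ξ : ι → X) (ρ : Equiv.Perm ι) :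
    energy Θ (fun i => ξ (ρ i)) = energy Θ ξ :=
  (ρ.prodCongr ρ).sum_comp fun p => (Θ (nndist (ξ p.1) (ξ p.2)) : ℝ) ^ 2

theorem energy_map {X : Type u} [MetricSpace X] (ξ : ι → X) (e : X ≃ᵢ X) :
    energy Θ (fun i => e (ξ i)) = energy Θ ξ := by
  simp only [energy, IsometryEquiv.nndist_eq]

/-- `Θ` grows at least linearly on the distances in `X`: compare a constant segment with a segment
of length `dist x y` at the parameter `1 / dist x y`. -/
theorem ThetaNPC1.mul_dist_le {X : Type u} [MetricSpace X] (h : ThetaNPC1 X Θ) (x y : X)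
    (hd : 1 ≤ dist x y) : dist x y * (Θ 1 - Θ 0) ≤ Θ (nndist x y) := by
  obtain ⟨γ, hγ, -⟩ := h.1 x y
  have hpos : 0 < dist x y := one_pos.trans_le hd
  let t : I := ⟨(dist x y)⁻¹, inv_nonneg.2 hpos.le, inv_le_one_of_one_le₀ hd⟩
  have ht : (t : ℝ) * dist x y = 1 := inv_mul_cancel₀ hpos.ne'
  have key := h.2 x x x y _ γ (isGeodesic_const x) hγ t
  have h1 : nndist x (γ t) = 1 := by
    ext
    rw [coe_nndist, hγ.dist_left, ht, NNReal.coe_one]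
  rw [h1, nndist_self] at key
  have h2 := mul_le_mul_of_nonneg_left key hpos.le
  have h3 : dist x y * ((1 - (t : ℝ)) * Θ 0 + t * Θ (nndist x y)) =
      (dist x y - t * dist x y) * Θ 0 + (t * dist x y) * Θ (nndist x y) := by ring
  rw [h3, ht] at h2
  have : (0 : ℝ) ≤ Θ 0 := NNReal.coe_nonneg _
  linarith

theorem ThetaNPC1.dist_le (hΘ : StrictMono Θ) {X : Type u} [MetricSpace X] (h : ThetaNPC1 X Θ)
    (ξ : ι → X) (i j : ι) : dist (ξ i) (ξ j) ≤ 1 + (1 + energy Θ ξ) / (Θ 1 - Θ 0) := by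
  have hpos : (0 : ℝ) < Θ 1 - Θ 0 := sub_pos.2 (NNReal.coe_lt_coe.2 (hΘ one_pos))
  have hE := energy_nonneg (Θ := Θ) ξ
  rcases le_or_gt 1 (dist (ξ i) (ξ j)) with hd | hd
  · have h1 := h.mul_dist_le _ _ hd
    have h2 := le_energy (Θ := Θ) ξ i j
    have : dist (ξ i) (ξ j) ≤ (1 + energy Θ ξ) / (Θ 1 - Θ 0) := by
      rw [le_div_iff₀ hpos]
      nlinarith [sq_nonneg ((Θ (nndist (ξ i) (ξ j)) : ℝ) - 1)]
    linarith
  · have : 0 ≤ (1 + energy Θ ξ) / (Θ 1 - Θ 0) := by positivity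
    linarith

/-- The least energy is attained, by an ultraproduct of a minimizing sequence. -/
theorem exists_isMinConfig [Nonempty ι] (hU : StableUltraproduct 𝒳) (hΘ : StrictMono Θ)
    (hΘc : Continuous Θ) (hNPC : ∀ X ∈ 𝒳, ThetaNPC1 X Θ)
    (hgen : Subgroup.closure (⋃ i, (M i : Set G)) = ⊤)
    {X₀ : MSpace.{u}} {α₀ : G →* (X₀ ≃ᵢ X₀)} {ξ₀ : ι → X₀} (h₀ : IsConfig 𝒳 S M X₀ α₀ ξ₀) :
    ∃ (X : MSpace.{u}) (α : G →* (X ≃ᵢ X)) (ξ : ι → X), IsMinConfig Θ 𝒳 S M X α ξ := by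
  let E : Set ℝ := {r | ∃ (X : MSpace.{u}) (α : G →* (X ≃ᵢ X)) (ξ : ι → X),
    IsConfig 𝒳 S M X α ξ ∧ energy Θ ξ = r}
  have hE₀ : E.Nonempty := ⟨_, X₀, α₀, ξ₀, h₀, rfl⟩
  have hEb : BddBelow E := ⟨0, by rintro _ ⟨X, α, ξ, -, rfl⟩; exact energy_nonneg ξ⟩
  obtain ⟨r, -, hr, hrE⟩ := exists_seq_tendsto_sInf hE₀ hEb
  choose X α ξ hconf hr' using hrE
  obtain ⟨B, hB⟩ := hr.bddAbove_range
  let C := 1 + (1 + B) / ((Θ 1 : ℝ) - Θ 0)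
  have hpos : (0 : ℝ) < Θ 1 - Θ 0 := sub_pos.2 (NNReal.coe_lt_coe.2 (hΘ one_pos))
  have hC : ∀ n i j, dist (ξ n i) (ξ n j) ≤ C := fun n i j => by
    refine ((hNPC _ (hconf n).mem).dist_le hΘ (ξ n) i j).trans ?_
    have : energy Θ (ξ n) ≤ B := hr' n ▸ hB ⟨n, rfl⟩
    simp only [C]
    gcongr
  let i₀ : ι := Classical.arbitrary ι
  have hw := bddAbove_displacement (fun n => ξ n i₀) α hgen fun g hg => by
    obtain ⟨i, hi⟩ := Set.mem_iUnion.1 hg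
    refine ⟨C + C, ?_⟩
    rintro _ ⟨n, rfl⟩
    refine (dist_triangle _ (ξ n i) _).trans (add_le_add ?_ (hC n i i₀))
    conv_lhs => rw [← (hconf n).fixed i g hi, IsometryEquiv.dist_eq]
    exact hC n i₀ i
  obtain ⟨𝒰, hne, h𝒰⟩ := hU
  obtain ⟨Y, hY, β, π, hπ, hd, hβ⟩ :=
    exists_ultraproduct_action h𝒰 (fun n => (hconf n).mem) (fun n => ξ n i₀) α hw
  let η : ι → BoundedSeq 𝒰 X (fun n => ξ n i₀) := fun i =>
    ⟨fun n => ξ n i, C, by rintro _ ⟨n, rfl⟩; exact hC n i i₀⟩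
  have hconf' : IsConfig 𝒳 S M Y β fun i => π (η i) :=
    { mem := hY
      uniform := isUniformAction_of_ultraproduct hπ hd hβ hw fun x =>
        Filter.Eventually.of_forall fun n => (hconf n).uniform (x.seq n)
      fixed := fun i m hm => hβ m (η i) (η i) fun n => ((hconf n).fixed i m hm).symm }
  refine ⟨Y, β, fun i => π (η i), { toIsConfig := hconf', energy_le := ?_ }⟩
  have hlim : Tendsto r 𝒰 (𝓝 (energy Θ fun i => π (η i))) := by
    have : r = fun n => energy Θ (ξ n) := funext fun n => (hr' n).symm
    rw [this]
    refine tendsto_finsetSum _ fun p _ => ?_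
    refine ((NNReal.continuous_coe.comp hΘc).continuousAt.tendsto.comp ?_).pow 2
    rw [← NNReal.tendsto_coe]
    exact hd (η p.1) (η p.2)
  have heq := tendsto_nhds_unique hlim (hr.mono_left (ultrafilter_le_atTop hne))
  intro X' α' ξ' h'
  rw [heq]
  exact csInf_le hEb ⟨X', α', ξ', h', rfl⟩

/-- Two minimal configurations in the same action are joined by mutually parallel segments: the
energy of the tuple of midpoints is not smaller, so equality holds in all convexity estimates. -/
theorem IsMinConfig.parallel (hΘ : StrictMono Θ) (hNPC : ∀ X ∈ 𝒳, ThetaNPC1 X Θ) {X : MSpace.{u}}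
    {α : G →* (X ≃ᵢ X)} {ξ η : ι → X} (hξ : IsMinConfig Θ 𝒳 S M X α ξ)
    (hη : IsMinConfig Θ 𝒳 S M X α η) (i j : ι) : Parallel (ξ i) (η i) (ξ j) (η j) := by
  have hX := hNPC X hξ.mem
  choose γ hγ hγu using fun i => hX.1 (ξ i) (η i)
  have hmid : IsConfig 𝒳 S M X α fun i => γ i half :=
    { mem := hξ.mem
      uniform := hξ.uniform
      fixed := fun i m hm => by
        have h1 := (hγ i).map (α m).isometry
        rw [hξ.fixed i m hm, hη.fixed i m hm] at h1
        exact congrFun (hγu i _ h1) half }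
  have hE : energy Θ ξ = energy Θ η :=
    le_antisymm (hξ.energy_le _ _ _ hη.toIsConfig) (hη.energy_le _ _ _ hξ.toIsConfig)
  have hE' := hξ.energy_le _ _ _ hmid
  let a : ι × ι → ℝ := fun p => Θ (nndist (ξ p.1) (ξ p.2))
  let b : ι × ι → ℝ := fun p => Θ (nndist (η p.1) (η p.2))
  let c : ι × ι → ℝ := fun p => Θ (nndist (γ p.1 half) (γ p.2 half))
  have hc0 : ∀ p, 0 ≤ c p := fun p => NNReal.coe_nonneg _
  have hc : ∀ p, c p ≤ (a p + b p) / 2 := fun p => by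
    refine (hX.2 _ _ _ _ _ _ (hγ p.1) (hγ p.2) half).trans_eq ?_
    simp only [coe_half, a, b]
    ring
  have hterm : ∀ p, 0 ≤ (a p ^ 2 + b p ^ 2) / 2 - c p ^ 2 := fun p => by
    nlinarith [hc p, hc0 p, sq_nonneg (a p - b p)]
  have hsum : ∑ p, ((a p ^ 2 + b p ^ 2) / 2 - c p ^ 2) ≤ 0 := by
    rw [Finset.sum_sub_distrib, ← Finset.sum_div, Finset.sum_add_distrib]
    change (energy Θ ξ + energy Θ η) / 2 - energy Θ (fun i => γ i half) ≤ 0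
    linarith
  have hzero := (Finset.sum_eq_zero_iff_of_nonneg fun p _ => hterm p).1
    (le_antisymm hsum (Finset.sum_nonneg fun p _ => hterm p)) (i, j) (Finset.mem_univ _)
  have hab : a (i, j) = b (i, j) := by
    have : (a (i, j) - b (i, j)) ^ 2 ≤ 0 := by nlinarith [hc (i, j), hc0 (i, j)]
    exact sub_eq_zero.1 (pow_eq_zero_iff two_ne_zero |>.1 (le_antisymm this (sq_nonneg _)))
  have hac : b (i, j) = c (i, j) := by
    have hb0 : 0 ≤ b (i, j) := NNReal.coe_nonneg _
    rw [hab] at hzero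
    exact (pow_left_inj₀ hb0 (hc0 _) two_ne_zero).1 (by linarith)
  have hinj : ∀ {p q : ℝ≥0}, (Θ p : ℝ) = Θ q → (p : ℝ) = q := fun h => by
    rw [hΘ.injective (NNReal.coe_injective h)]
  exact ⟨γ i, γ j, hγ i, hγ j, hinj hab, hinj hac⟩

/-- Segments joining two minimal configurations have a `G`-invariant direction: each `M j` fixes
one of these parallel segments. -/
theorem IsMinConfig.parallel_smul (hΘ : StrictMono Θ) (hNPC : ∀ X ∈ 𝒳, ThetaNPC1 X Θ)
    {X : MSpace.{u}} (hT : TP X) (hgen : Subgroup.closure (⋃ i, (M i : Set G)) = ⊤)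
    {α : G →* (X ≃ᵢ X)} {ξ η : ι → X} (hξ : IsMinConfig Θ 𝒳 S M X α ξ)
    (hη : IsMinConfig Θ 𝒳 S M X α η) (i : ι) (g : G) :
    Parallel (α g (ξ i)) (α g (η i)) (ξ i) (η i) := by
  have hg : g ∈ Subgroup.closure (⋃ i, (M i : Set G)) := hgen ▸ Subgroup.mem_top g
  induction hg using Subgroup.closure_induction with
  | mem m hm =>
    obtain ⟨j, hj⟩ := Set.mem_iUnion.1 hm
    have h1 := (hξ.parallel hΘ hNPC hη i j).map (α m).isometry
    rw [hξ.fixed j m hj, hη.fixed j m hj] at h1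
    exact hT _ _ _ _ _ _ h1 (hξ.parallel hΘ hNPC hη j i)
  | one => simpa using (hNPC X hξ.mem).1.parallel_refl (ξ i) (η i)
  | mul g h _ _ ihg ihh =>
    simp only [map_mul, IsometryEquiv.mul_apply]
    exact hT _ _ _ _ _ _ (ihh.map (α g).isometry) ihg
  | inv g _ ih =>
    have := ih.map (α g⁻¹).isometry
    simp only [← IsometryEquiv.mul_apply, ← map_mul, inv_mul_cancel, map_one,
      IsometryEquiv.coe_one, id] at this
    exact this.symm

end Configurations

/-! ### The games -/

section Games

variable {G : Type v} [Group G] {l : ℕ} {Θ : ℝ≥0 → ℝ≥0} {𝒳 : Set MSpace.{u}} {S : Finset G}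
  {M : Fin l → Subgroup G} {Φ : Subgroup (MulAut G)} {H H' : Fin l → Subgroup G}

/-- The invariant of the game: in every minimal configuration, `H i` fixes the `i`-th point. -/
def FixesMinConfigs (Θ : ℝ≥0 → ℝ≥0) (𝒳 : Set MSpace.{u}) (S : Finset G)
    (M H : Fin l → Subgroup G) : Prop :=
  ∀ (X : MSpace.{u}) (α : G →* (X ≃ᵢ X)) (ξ : Fin l → X), IsMinConfig Θ 𝒳 S M X α ξ →
    ∀ i, H i ≤ pointStabilizer α (ξ i)

/-- Elements of `P` that all translate a point `x` in an action on a member of `𝒳` fix `x`. -/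
def NoTranslations (h2 : ∀ X ∈ 𝒳, NPC2 X) (hT : ∀ X ∈ 𝒳, TP X) (P : Set G) : Prop :=
  ∀ (X : MSpace.{u}) (hX : X ∈ 𝒳) (α : G →* (X ≃ᵢ X)) (x : X),
    P ⊆ translations (h2 X hX) (hT X hX) α x → P ⊆ pointStabilizer α x

/-- Twisting the action by `φ` and permuting the points by `ρ⁻¹` gives another minimal
configuration. -/
theorem FixesMinConfigs.moveII (hS : ∀ φ ∈ Φ, ∀ s ∈ S, φ s ∈ S)
    (hH : FixesMinConfigs Θ 𝒳 S M H) (hmove : MoveII M Φ H H') :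
    FixesMinConfigs Θ 𝒳 S M H' := by
  obtain ⟨ρ, Λ, hΛ, hle, hH'⟩ := hmove
  intro X α ξ hξ i
  rw [hH' i]
  refine sup_le (hH X α ξ hξ i) (iSup₂_le fun φ hφ => ?_)
  have hmin : IsMinConfig Θ 𝒳 S M X (α.comp φ.toMonoidHom) fun j => ξ (ρ.symm j) :=
    { mem := hξ.mem
      uniform := hξ.uniform.comp_innMul hS (hΛ hφ)
      fixed := fun j m hm => by
        have h1 := hle φ hφ (ρ.symm j)
        rw [ρ.apply_symm_apply] at h1
        exact hH X α ξ hξ _ (h1 (Subgroup.mem_map_of_mem _ hm))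
      energy_le := fun X' α' ξ' h' => by
        rw [energy_comp_perm ξ ρ.symm]
        exact hξ.energy_le X' α' ξ' h' }
  rw [Subgroup.map_le_iff_le_comap]
  intro g hg
  have : α (φ g) (ξ (ρ.symm (ρ i))) = ξ (ρ.symm (ρ i)) := hH _ _ _ hmin (ρ i) hg
  rwa [ρ.symm_apply_apply] at this

/-- Moving the points by `h ∈ P` and permuting them by `τ⁻¹` gives another minimal configuration,
so that `h` translates the points `ξ i` with `τ i = i`. -/
theorem FixesMinConfigs.moveIPlus (hΘ : StrictMono Θ) (h1 : ∀ X ∈ 𝒳, ThetaNPC1 X Θ)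
    (h2 : ∀ X ∈ 𝒳, NPC2 X) (hT : ∀ X ∈ 𝒳, TP X)
    (hgen : Subgroup.closure (⋃ i, (M i : Set G)) = ⊤) {P : Set G} (hP : NoTranslations h2 hT P)
    (hH : FixesMinConfigs Θ 𝒳 S M H) (hmove : MoveIPlus M P H H') :
    FixesMinConfigs Θ 𝒳 S M H' := by
  obtain ⟨τ, -, hle, hH'⟩ := hmove
  intro X α ξ hξ i
  by_cases hi : τ i = i
  swap
  · rw [(hH' i).2 hi]
    exact hH X α ξ hξ i
  rw [(hH' i).1 hi]
  refine sup_le (hH X α ξ hξ i) ((Subgroup.closure_le _).2 (hP X hξ.mem α _ fun h hh => ?_))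
  have hmin : IsMinConfig Θ 𝒳 S M X α fun j => α h (ξ (τ.symm j)) :=
    { mem := hξ.mem
      uniform := hξ.uniform
      fixed := fun j m hm => by
        have h3 := hle h hh (τ.symm j)
        rw [τ.apply_symm_apply] at h3
        obtain ⟨k, hk, rfl⟩ := h3 hm
        have h4 : α k (ξ (τ.symm j)) = ξ (τ.symm j) := hH X α ξ hξ _ hk
        simp [MulAut.conj_apply, h4]
      energy_le := fun X' α' ξ' h' => by
        rw [energy_map (fun j => ξ (τ.symm j)) (α h), energy_comp_perm ξ τ.symm]
        exact hξ.energy_le X' α' ξ' h' }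
  have hi' : τ.symm i = i := by rw [Equiv.symm_apply_eq, hi]
  intro g
  have := hξ.parallel_smul hΘ h1 (hT X hξ.mem) hgen hmin i g
  simpa only [hi', map_mul, IsometryEquiv.mul_apply] using this

/-- If all moves of type (I) use sets without non-trivial translations, then the invariant persists
until the end of a won game, where it gives a global fixed point in a uniform action. Hence there
are no uniform actions, and so no actions without fixed points. -/
theorem propertyF_of_reflTransGen [Group.FG G] (hS : StableScaleUp 𝒳) (hU : StableUltraproduct 𝒳)
    (hΘ : StrictMono Θ) (hΘc : Continuous Θ) (h1 : ∀ X ∈ 𝒳, ThetaNPC1 X Θ)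
    (h2 : ∀ X ∈ 𝒳, NPC2 X) (hT : ∀ X ∈ 𝒳, TP X)
    (hgen : Subgroup.closure (⋃ i, (M i : Set G)) = ⊤) [Finite Φ]
    (hrel : ∀ i, RelPropertyF 𝒳 (M i)) {R : (Fin l → Subgroup G) → (Fin l → Subgroup G) → Prop}
    (hR : ∀ H H', R H H' →
      (∃ P, NoTranslations h2 hT P ∧ MoveIPlus M P H H') ∨ MoveII M Φ H H')
    (hgame : Relation.ReflTransGen R M H) {i₀ : Fin l} (hH : H i₀ = ⊤) : PropertyF G 𝒳 := by
  intro X hX α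
  by_contra hα
  obtain ⟨S, hSgen, hSΦ⟩ := exists_finset_closure_eq_top Φ
  obtain ⟨Y, hY, β, hβ⟩ := exists_isUniformAction hS hU hX α hα hSgen
  choose ξ₀ hξ₀ using fun i => hrel i Y hY β
  have : Nonempty (Fin l) := ⟨i₀⟩
  obtain ⟨Z, γ, ξ, hξ⟩ := exists_isMinConfig hU hΘ hΘc h1 hgen
    (show IsConfig 𝒳 S M Y β ξ₀ from ⟨hY, hβ, hξ₀⟩)
  have hinv : FixesMinConfigs Θ 𝒳 S M H := by
    clear hH
    induction hgame with
    | refl => exact fun X α ξ hξ i m hm => hξ.fixed i m hm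
    | tail _ hstep ih =>
      rcases hR _ _ hstep with ⟨P, hP, hmove⟩ | hmove
      · exact ih.moveIPlus hΘ h1 h2 hT hgen hP hmove
      · exact ih.moveII hSΦ hmove
  obtain ⟨s, -, hs⟩ := hξ.uniform (ξ i₀)
  have hfix : γ s (ξ i₀) = ξ i₀ := hinv Z γ ξ hξ i₀ (hH ▸ Subgroup.mem_top s)
  rw [hfix, dist_self] at hs
  exact absurd hs (by norm_num)

end Games

/-! ### CAT(0) spaces -/

section CATZero

open Filter Topology

variable {X : Type u} [MetricSpace X]

/-- Existence of comparison triangles. -/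
theorem exists_comparison_triangle (a b c : X) : ∃ a' b' c' : EuclideanSpace ℝ (Fin 2),
    dist a' b' = dist a b ∧ dist a' c' = dist a c ∧ dist b' c' = dist b c := by
  have hd : ∀ u v : EuclideanSpace ℝ (Fin 2), ∀ r : ℝ, 0 ≤ r →
      (u 0 - v 0) ^ 2 + (u 1 - v 1) ^ 2 = r ^ 2 → dist u v = r := by
    intro u v r hr h
    rw [EuclideanSpace.dist_eq, Fin.sum_univ_two, Real.dist_eq, Real.dist_eq, sq_abs, sq_abs, h,
      Real.sqrt_sq hr]
  have t1 := dist_triangle a b c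
  have t2 := dist_triangle_left b c a
  have t3 := dist_triangle_right a b c
  have p0 : 0 ≤ dist a b := dist_nonneg
  have q0 : 0 ≤ dist a c := dist_nonneg
  have r0 : 0 ≤ dist b c := dist_nonneg
  generalize dist a b = p at *
  generalize dist a c = q at *
  generalize dist b c = r at *
  rcases q0.eq_or_lt with rfl | hq
  · obtain rfl : p = r := by linarith
    refine ⟨!₂[0, 0], !₂[p, 0], !₂[0, 0], hd _ _ _ p0 ?_, hd _ _ _ le_rfl ?_, hd _ _ _ p0 ?_⟩ <;>
      simp
  · -- Put `a'` at the origin and `c'` on the first axis; `s` is the first coordinate of `b'`.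
    obtain ⟨s, hs⟩ : ∃ s, 2 * q * s = p ^ 2 + q ^ 2 - r ^ 2 :=
      ⟨(p ^ 2 + q ^ 2 - r ^ 2) / (2 * q), by field_simp⟩
    have hsp : s ≤ p := by nlinarith
    have hsp' : -p ≤ s := by nlinarith
    have hw : 0 ≤ p ^ 2 - s ^ 2 := by nlinarith
    have hw' := Real.sq_sqrt hw
    refine ⟨!₂[0, 0], !₂[s, √(p ^ 2 - s ^ 2)], !₂[q, 0], hd _ _ _ p0 ?_, hd _ _ _ hq.le ?_,
      hd _ _ _ r0 ?_⟩ <;> simp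
    · rw [hw']; ring
    · rw [hw']; linarith

/-- The inequality of Bruhat and Tits. -/
theorem IsCAT0.dist_half_sq_le (hX : IsCAT0 X) {a c : X} {γ : I → X} (hγ : IsGeodesic a c γ)
    (b : X) : dist b (γ half) ^ 2 ≤
      dist a b ^ 2 / 2 + dist b c ^ 2 / 2 - dist a c ^ 2 / 4 := by
  obtain ⟨a', b', c', h1, h2, h3⟩ := exists_comparison_triangle a b c
  obtain ⟨γ', hγ'⟩ := hX.1 a b
  have key := hX.2 a b c γ' γ hγ' hγ a' b' c' h1 h2 h3 1 half
  rw [hγ'.2.1, Set.Icc.coe_one, AffineMap.lineMap_apply_one, coe_half] at key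
  refine (pow_le_pow_left₀ dist_nonneg key 2).trans_eq ?_
  have := parallelogram_law_with_norm ℝ (b' - a') (b' - c')
  have e1 : b' - a' + (b' - c') = (2 : ℝ) • (b' - AffineMap.lineMap a' c' (1 / 2 : ℝ)) := by
    rw [AffineMap.lineMap_apply_module]
    module
  have e2 : b' - a' - (b' - c') = c' - a' := by abel
  rw [e1, e2, norm_smul, ← dist_eq_norm, ← dist_eq_norm, ← dist_eq_norm, ← dist_eq_norm,
    dist_comm b' a', dist_comm c' a', h1, h2, h3, Real.norm_ofNat] at this
  linarith

/-- In a quadrilateral, the sum of the squares of the diagonals is at most the sum of the squares of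
the sides. -/
theorem IsCAT0.quadrilateral (hX : IsCAT0 X) (a b c e : X) :
    dist a c ^ 2 + dist b e ^ 2 ≤
      dist a b ^ 2 + dist b c ^ 2 + dist c e ^ 2 + dist a e ^ 2 := by
  obtain ⟨γ, hγ⟩ := hX.1 a c
  have h1 := hX.dist_half_sq_le hγ b
  have h2 := hX.dist_half_sq_le hγ e
  have h3 := dist_triangle_right b e (γ half)
  have h4 : dist b e ^ 2 ≤ (dist b (γ half) + dist e (γ half)) ^ 2 :=
    pow_le_pow_left₀ dist_nonneg h3 2
  rw [dist_comm e c] at h2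
  nlinarith [sq_nonneg (dist b (γ half) - dist e (γ half))]

variable {G : Type v} [Group G]

/-- A translation moves every point of a `CAT(0)` space along a ray, whose Busemann function is
preserved by every subgroup with a fixed point, since rays at bounded distance have the same
Busemann function up to a constant. Hence there is no non-trivial translation if such subgroups
generate the group. -/
theorem IsCAT0.apply_eq_of_mem_translations (hX : IsCAT0 X) {h2 : NPC2 X} (h3 : NPC3 X) {hT : TP X}
    {α : G →* (X ≃ᵢ X)} {x : X} {h : G} (hh : h ∈ translations h2 hT α x) {ι : Type*}
    {M : ι → Subgroup G} (hgen : Subgroup.closure (⋃ i, (M i : Set G)) = ⊤)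
    (hfix : ∀ i, (fixedSet α (M i)).Nonempty) : α h x = x := by
  by_contra hne
  have hc : 0 < dist x (α h x) := dist_pos.2 fun e => hne e.symm
  let p : ℕ → X := fun n => α (h ^ n) x
  have hp : ∀ n, dist x (p n) = n * dist x (α h x) := dist_pow_of_mem_translations h3 hh
  have hbdd : ∀ g n, dist (α g (p n)) (p n) = dist (α g x) x := fun g n => by
    have := (pow_mem hh n g).dist_eq
    rw [map_mul, IsometryEquiv.mul_apply] at this
    exact this.symm
  have hinfty : ∀ y, Tendsto (fun n => dist y (p n)) atTop atTop := fun y => by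
    refine tendsto_atTop_mono (f := fun n : ℕ => -dist x y + n * dist x (α h x)) (fun n => ?_) ?_
    · rw [← hp]
      linarith [dist_triangle x y (p n)]
    · exact tendsto_atTop_add_const_left _ _
        (tendsto_natCast_atTop_atTop.atTop_mul_const hc)
  -- Along the ray, all elements of `G` preserve the limit of the differences of distances.
  have key : ∀ g y, Tendsto (fun n => dist (α g y) (p n) - dist y (p n)) atTop (𝓝 0) := by
    intro g
    have hg : g ∈ Subgroup.closure (⋃ i, (M i : Set G)) := hgen ▸ Subgroup.mem_top g
    induction hg using Subgroup.closure_induction with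
    | mem m hm =>
      intro y
      obtain ⟨j, hj⟩ := Set.mem_iUnion.1 hm
      obtain ⟨z, hz⟩ := hfix j
      have hz : α m z = z := hz m hj
      let K := dist y z ^ 2 + dist (α m x) x ^ 2
      refine squeeze_zero_norm' (a := fun n => K / dist y (p n)) ?_
        (tendsto_const_nhds.div_atTop (hinfty y))
      filter_upwards [(hinfty y).eventually_gt_atTop 0] with n hn
      have a1 := hX.quadrilateral (α m y) z (p n) (α m (p n))
      have a2 := hX.quadrilateral (α m y) z (α m (p n)) (p n)
      have e1 : dist (α m y) z = dist y z := by
        conv_lhs => rw [← hz, IsometryEquiv.dist_eq]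
      have e2 : dist z (α m (p n)) = dist z (p n) := by
        conv_lhs => rw [← hz, IsometryEquiv.dist_eq]
      rw [IsometryEquiv.dist_eq, e1, e2, dist_comm (p n) (α m (p n)), hbdd] at a1
      rw [IsometryEquiv.dist_eq, e1, e2, hbdd] at a2
      have a3 : |dist (α m y) (p n) - dist y (p n)| * (dist (α m y) (p n) + dist y (p n)) ≤ K := by
        rw [← abs_of_nonneg (add_nonneg (dist_nonneg (x := α m y) (y := p n))
          (dist_nonneg (x := y) (y := p n))), ← abs_mul, abs_le]
        constructor <;> linarith
      rw [le_div_iff₀ hn, Real.norm_eq_abs]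
      refine le_trans (mul_le_mul_of_nonneg_left ?_ (abs_nonneg _)) a3
      linarith [dist_nonneg (x := α m y) (y := p n)]
    | one => simp
    | mul g k _ _ ihg ihk =>
      intro y
      have := (ihg (α k y)).add (ihk y)
      simpa using this
    | inv g _ ih =>
      intro y
      have := (ih (α g⁻¹ y)).neg
      simpa using this
  have := (key h x).comp (tendsto_add_atTop_nat 1)
  have hconst : ∀ n : ℕ, dist (α h x) (p (n + 1)) - dist x (p (n + 1)) = -dist x (α h x) := by
    intro n
    have : dist (α h x) (p (n + 1)) = dist x (p n) := by
      simp only [p, pow_succ', map_mul, IsometryEquiv.mul_apply, IsometryEquiv.dist_eq]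
    rw [this, hp, hp]
    push_cast
    ring
  have h0 := tendsto_nhds_unique this (tendsto_const_nhds.congr fun n => (hconst n).symm)
  linarith

end CATZero

/-! ### Banach spaces: parallelism and uniform convexity -/

section Banach

open Filter Topology

variable {E : Type u} [NormedAddCommGroup E] [NormedSpace ℝ E]

theorem isGeodesic_lineMap (x y : E) :
    IsGeodesic x y fun t : I => AffineMap.lineMap x y (t : ℝ) := by
  refine ⟨by simp, by simp, fun s t => ?_⟩
  rw [dist_lineMap_lineMap, Real.dist_eq]

/-- In a uniquely geodesic normed space, parallel segments differ by a translation. -/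
theorem Parallel.sub_eq_sub (hE : UniquelyGeodesic E) {x y x' y' : E} (h : Parallel x y x' y') :
    y - x = y' - x' := by
  obtain ⟨γ, γ', hγ, hγ', h1, h2⟩ := h
  rw [(hE x y).unique hγ (isGeodesic_lineMap x y), (hE x' y').unique hγ' (isGeodesic_lineMap x' y'),
    dist_eq_norm, dist_eq_norm] at h2
  rw [dist_eq_norm, dist_eq_norm] at h1
  have e : AffineMap.lineMap x y ((half : I) : ℝ) - AffineMap.lineMap x' y' ((half : I) : ℝ) =
      (1 / 2 : ℝ) • ((x - x') + (y - y')) := by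
    rw [AffineMap.lineMap_apply_module, AffineMap.lineMap_apply_module, coe_half]
    module
  rw [e, norm_smul] at h2
  norm_num at h2
  have hmid : x - x' = y - y' := by
    apply hE.eq_of_midpoint (x := 0) (z := (x - x') + (y - y')) <;>
      simp only [dist_zero_left, dist_self_add_right, dist_add_self_right] <;> linarith
  rw [sub_eq_sub_iff_add_eq_add] at hmid ⊢
  rw [← hmid, add_comm]

/-- A normed space isometric to a member of a class of uniquely geodesic spaces that is closed under
ultraproducts is uniformly convex, since its ultrapower is strictly convex. The conclusion is a
quantitative form of this. -/
theorem exists_uniform_convexity {E : Type u} [NormedAddCommGroup E] {𝒳 : Set MSpace.{u}}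
    (hU : StableUltraproduct 𝒳) (hgeo : ∀ X ∈ 𝒳, UniquelyGeodesic X) {X : MSpace.{u}}
    (hX : X ∈ 𝒳) (e : X ≃ᵢ E) {ε : ℝ}
    (hε : 0 < ε) : ∃ κ > 0, ∀ a b : E, ‖a‖ ≤ 1 → ‖b‖ ≤ 1 →
      ‖a + b‖ ^ 2 + κ * (‖a - b‖ - ε) ≤ 2 * (‖a‖ ^ 2 + ‖b‖ ^ 2) := by
  obtain ⟨δ, hδ, h⟩ : ∃ δ > 0, ∀ a b : E, ‖a‖ ≤ 1 → ‖b‖ ≤ 1 → ε ≤ ‖a - b‖ →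
      ‖a + b‖ ^ 2 + δ ≤ 2 * (‖a‖ ^ 2 + ‖b‖ ^ 2) := by
    by_contra! hcon
    choose a b ha hb hab hlt using fun n : ℕ => hcon (1 / ((n : ℝ) + 1)) Nat.one_div_pos_of_nat
    obtain ⟨𝒰, hne, h𝒰⟩ := hU
    obtain ⟨Y, hY, π, -, hπ⟩ := exists_ultraproduct h𝒰 (fun _ => hX) (fun _ => e.symm 0)
    let q : (z : ℕ → E) → (∀ n, ‖z n‖ ≤ 2) → BoundedSeq 𝒰 (fun _ => X) (fun _ => e.symm 0) :=
      fun z hz => ⟨fun n => e.symm (z n), 2, by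
        rintro _ ⟨n, rfl⟩
        simp only [IsometryEquiv.dist_eq, dist_zero_right]
        exact hz n⟩
    have hq : ∀ z hz z' hz', Tendsto (fun n => ‖z n - z' n‖) 𝒰
        (𝓝 (dist (π (q z hz)) (π (q z' hz')))) := fun z hz z' hz' => by
      refine (hπ _ _).congr fun n => ?_
      rw [← dist_eq_norm]
      exact e.symm.dist_eq _ _
    have h0' : ∀ n : ℕ, ‖(0 : E)‖ ≤ 2 := fun _ => by simp
    have ha' : ∀ n, ‖a n‖ ≤ 2 := fun n => (ha n).trans one_le_two
    have hb' : ∀ n, ‖b n‖ ≤ 2 := fun n => (hb n).trans one_le_two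
    have hab' : ∀ n, ‖a n + b n‖ ≤ 2 := fun n => (norm_add_le _ _).trans
      (by linarith [ha n, hb n])
    let O := q _ h0'
    let A := q _ ha'
    let B := q _ hb'
    let C := q _ hab'
    have hOA : Tendsto (fun n => ‖a n‖) 𝒰 (𝓝 (dist (π O) (π A))) := by
      simpa using hq _ h0' _ ha'
    have hOB : Tendsto (fun n => ‖b n‖) 𝒰 (𝓝 (dist (π O) (π B))) := by
      simpa using hq _ h0' _ hb'
    have hAC : Tendsto (fun n => ‖b n‖) 𝒰 (𝓝 (dist (π A) (π C))) := by
      simpa using hq _ ha' _ hab'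
    have hBC : Tendsto (fun n => ‖a n‖) 𝒰 (𝓝 (dist (π B) (π C))) := by
      simpa using hq _ hb' _ hab'
    have hOC : Tendsto (fun n => ‖a n + b n‖) 𝒰 (𝓝 (dist (π O) (π C))) := by
      simpa only [zero_sub, norm_neg] using hq _ h0' _ hab'
    have hAB : ε ≤ dist (π A) (π B) := ge_of_tendsto' (hq _ ha' _ hb') hab
    have h1 := tendsto_nhds_unique hOA hBC
    have h2 := tendsto_nhds_unique hOB hAC
    have hzero : Tendsto (fun n : ℕ => 1 / ((n : ℝ) + 1)) 𝒰 (𝓝 0) :=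
      tendsto_one_div_add_atTop_nhds_zero_nat.mono_left (ultrafilter_le_atTop hne)
    have h3 := le_of_tendsto_of_tendsto' (((hOA.pow 2).add (hOB.pow 2)).const_mul 2)
      ((hOC.pow 2).add hzero) fun n => (hlt n).le
    have h4 := dist_triangle (π O) (π A) (π C)
    rw [← h2] at h4
    have p1 : 0 ≤ dist (π O) (π A) := dist_nonneg
    have p2 : 0 ≤ dist (π O) (π B) := dist_nonneg
    have p3 : 0 ≤ dist (π O) (π C) := dist_nonneg
    have h5 : dist (π O) (π A) = dist (π O) (π B) := by
      have : (dist (π O) (π A) - dist (π O) (π B)) ^ 2 ≤ 0 := by nlinarith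
      exact sub_eq_zero.1 (pow_eq_zero_iff two_ne_zero |>.1 (le_antisymm this (sq_nonneg _)))
    have h6 : dist (π O) (π C) = 2 * dist (π O) (π A) := by
      refine le_antisymm (by linarith) (abs_le_of_sq_le_sq' ?_ p3).2
      rw [← h5] at h3
      linarith
    have : π A = π B := (hgeo Y hY).eq_of_midpoint (x := π O) (z := π C) (by linarith)
      (by linarith) (by linarith) (by linarith)
    rw [this, dist_self] at hAB
    linarith
  refine ⟨δ / 2, half_pos hδ, fun a b ha hb => ?_⟩
  rcases le_or_gt ε ‖a - b‖ with hab | hab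
  · have := norm_sub_le a b
    nlinarith [h a b ha hb hab]
  · have h1 := pow_le_pow_left₀ (norm_nonneg _) (norm_add_le a b) 2
    nlinarith [sq_nonneg (‖a‖ - ‖b‖)]

/-! ### Random walks of affine isometries -/

/-- The mean of a finite family of vectors. -/
noncomputable def mean {ι : Type*} [Fintype ι] {F : Type*} [AddCommGroup F] [Module ℝ F]
    (f : ι → F) : F :=
  (Fintype.card ι : ℝ)⁻¹ • ∑ k, f k

section Mean

variable {ι : Type*} [Fintype ι] {F : Type*} [AddCommGroup F] [Module ℝ F]

theorem mean_const [Nonempty ι] (c : F) : mean (fun _ : ι => c) = c := by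
  rw [mean, Finset.sum_const, Finset.card_univ, ← Nat.cast_smul_eq_nsmul ℝ, smul_smul,
    inv_mul_cancel₀ (by exact_mod_cast Fintype.card_ne_zero), one_smul]

theorem mean_add (f g : ι → F) : mean (fun k => f k + g k) = mean f + mean g := by
  rw [mean, Finset.sum_add_distrib, smul_add, mean, mean]

theorem mean_map {F' : Type*} [AddCommGroup F'] [Module ℝ F'] (L : F →ₗ[ℝ] F') (f : ι → F) :
    mean (fun k => L (f k)) = L (mean f) := by
  rw [mean, mean, map_smul, map_sum]

theorem mean_const_mul (c : ℝ) (f : ι → ℝ) : mean (fun k => c * f k) = c * mean f :=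
  mean_map (LinearMap.mulLeft ℝ c) f

theorem mean_prod {κ : Type*} [Fintype κ] (f : ι × κ → F) :
    mean f = mean fun i => mean fun j => f (i, j) := by
  simp only [mean, Fintype.card_prod, Fintype.sum_prod_type, ← Finset.smul_sum, smul_smul]
  rw [Nat.cast_mul, mul_inv]

theorem mean_comm {κ : Type*} [Fintype κ] (f : ι → κ → F) :
    (mean fun i => mean fun j => f i j) = mean fun j => mean fun i => f i j := by
  simp only [mean, ← Finset.smul_sum]
  rw [Finset.sum_comm, smul_comm]

theorem mean_mono {f g : ι → ℝ} (h : ∀ k, f k ≤ g k) : mean f ≤ mean g :=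
  mul_le_mul_of_nonneg_left (Finset.sum_le_sum fun k _ => h k) (by positivity)

theorem mean_nonneg {f : ι → ℝ} (h : ∀ k, 0 ≤ f k) : 0 ≤ mean f :=
  mul_nonneg (by positivity) (Finset.sum_nonneg fun k _ => h k)

theorem norm_mean_le (f : ι → E) : ‖mean f‖ ≤ mean fun k => ‖f k‖ := by
  rw [mean, norm_smul, Real.norm_of_nonneg (by positivity)]
  exact mul_le_mul_of_nonneg_left (norm_sum_le _ _) (by positivity)

theorem mean_affineIsometry [Nonempty ι] (A : E ≃ᵃⁱ[ℝ] E) (f : ι → E) :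
    mean (fun k => A (f k)) = A (mean f) := by
  have hA : ∀ z, A z = A.linearIsometryEquiv z + A 0 := fun z => by
    simpa using A.map_vadd 0 z
  rw [hA (mean f), ← mean_const (ι := ι) (A 0)]
  simp only [hA (f _)]
  rw [mean_add, mean_const]
  congr 1
  exact mean_map A.linearIsometryEquiv.toLinearEquiv.toLinearMap f

end Mean

/-- One step of a random walk by affine isometries with centred displacement of the origin, whose
inverse has drift `u` at `o`, where `u` is invariant under the linear parts. -/
structure IsDriftingWalk {ι : Type*} [Fintype ι] (A : ι → E ≃ᵃⁱ[ℝ] E) (o u : E) (R : ℝ) :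
    Prop where
  linear_apply : ∀ k, (A k).linearIsometryEquiv u = u
  mean_apply : mean (fun k => A k 0) = 0
  mean_symm_apply : mean (fun k => (A k).symm o) = o + u
  norm_le : ∀ k, ‖A k 0‖ ≤ R

namespace IsDriftingWalk

variable {ι : Type*} [Fintype ι] [Nonempty ι] {A : ι → E ≃ᵃⁱ[ℝ] E} {o u : E} {R : ℝ}

/-- Two independent steps. -/
theorem prod (h : IsDriftingWalk A o u R) :
    IsDriftingWalk (fun p : ι × ι => (A p.2).trans (A p.1)) o ((2 : ℝ) • u) (2 * R) where
  linear_apply p := by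
    rw [map_smul]
    congr 1
    have : ((A p.2).trans (A p.1)).linearIsometryEquiv u =
        (A p.1).linearIsometryEquiv ((A p.2).linearIsometryEquiv u) := rfl
    rw [this, h.linear_apply, h.linear_apply]
  mean_apply := by
    rw [mean_prod]
    have : ∀ i, (mean fun j => (A j).trans (A i) 0) = A i 0 := fun i => by
      conv_rhs => rw [← h.mean_apply, ← mean_affineIsometry]
      rfl
    simp only [this, h.mean_apply]
  mean_symm_apply := by
    have hu : ∀ j, (A j).symm (o + u) = (A j).symm o + u := fun j => by
      have := (A j).symm.map_vadd o u
      have hs : (A j).symm.linearIsometryEquiv u = u := by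
        conv_lhs => rw [← h.linear_apply j]
        exact (A j).linearIsometryEquiv.symm_apply_apply u
      rw [vadd_eq_add, vadd_eq_add, hs] at this
      rw [add_comm, this, add_comm]
    have : ∀ j, (mean fun i => ((A j).trans (A i)).symm o) = (A j).symm o + u := fun j => by
      rw [← hu, ← h.mean_symm_apply, ← mean_affineIsometry]
      rfl
    rw [mean_prod, mean_comm]
    simp only [this]
    rw [mean_add, mean_const, h.mean_symm_apply, two_smul, add_assoc]
  norm_le p := by
    have h1 : dist (A p.1 (A p.2 0)) (A p.1 0) = ‖A p.2 0‖ := by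
      rw [AffineIsometryEquiv.dist_map, dist_zero_right]
    have h2 := dist_triangle (A p.1 (A p.2 0)) (A p.1 0) 0
    rw [h1, dist_zero_right, dist_zero_right] at h2
    have := h.norm_le p.1
    have := h.norm_le p.2
    change ‖A p.1 (A p.2 0)‖ ≤ _
    linarith

theorem norm_drift_le (h : IsDriftingWalk A o u R) : ‖u‖ ≤ 2 * ‖o‖ + mean fun k => ‖A k 0‖ := by
  have h1 : ‖o + u‖ ≤ mean fun k => (‖o‖ + ‖A k 0‖) := by
    rw [← h.mean_symm_apply]
    refine (norm_mean_le _).trans (mean_mono fun k => ?_)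
    rw [← dist_zero_right, ← (A k).dist_map, AffineIsometryEquiv.apply_symm_apply, dist_eq_norm]
    exact norm_sub_le _ _
  rw [mean_add, mean_const] at h1
  have h2 := norm_sub_le (o + u) o
  rw [add_sub_cancel_left] at h2
  linarith

/-- Uniform convexity makes the second moment of two independent steps smaller than four times the
second moment of one step, because the second step is centred given the first one. -/
theorem mean_sq_prod_le (h : IsDriftingWalk A o u R) (hR : 0 < R) {κ ε : ℝ} (hκ : 0 < κ)
    (hconv : ∀ a b : E, ‖a‖ ≤ 1 → ‖b‖ ≤ 1 →
      ‖a + b‖ ^ 2 + κ * (‖a - b‖ - ε) ≤ 2 * (‖a‖ ^ 2 + ‖b‖ ^ 2)) :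
    (mean fun p : ι × ι => ‖(A p.2).trans (A p.1) 0‖ ^ 2) +
      κ * R * ((mean fun k => ‖A k 0‖) - ε * R) ≤ 4 * mean fun k => ‖A k 0‖ ^ 2 := by
  have hscale : ∀ a b : E, ‖a‖ ≤ R → ‖b‖ ≤ R →
      ‖a + b‖ ^ 2 + κ * R * (‖a - b‖ - ε * R) ≤ 2 * (‖a‖ ^ 2 + ‖b‖ ^ 2) := by
    intro a b ha hb
    have hn : ∀ z : E, ‖R⁻¹ • z‖ = ‖z‖ / R := fun z => by
      rw [norm_smul, Real.norm_of_nonneg (inv_nonneg.2 hR.le), div_eq_inv_mul]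
    have := hconv (R⁻¹ • a) (R⁻¹ • b) (by rw [hn]; exact div_le_one_of_le₀ ha hR.le)
      (by rw [hn]; exact div_le_one_of_le₀ hb hR.le)
    rw [← smul_add, ← smul_sub, hn, hn, hn, hn] at this
    have h2 := mul_le_mul_of_nonneg_left this (sq_nonneg R)
    field_simp at h2
    linarith
  have hstep : ∀ i, (mean fun j => ‖A i (A j 0)‖ ^ 2) + κ * R * (‖A i 0‖ - ε * R) ≤
      2 * (‖A i 0‖ ^ 2 + mean fun j => ‖A j 0‖ ^ 2) := by
    intro i
    let L := (A i).linearIsometryEquiv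
    have hA : ∀ z, A i z = A i 0 + L z := fun z => by
      have := (A i).map_vadd 0 z
      rw [vadd_eq_add, vadd_eq_add, add_zero] at this
      rw [this, add_comm]
    have h1 : ‖A i 0‖ ≤ mean fun j => ‖A i 0 - L (A j 0)‖ := by
      refine le_trans (le_of_eq ?_) (norm_mean_le _)
      have : (mean fun j => A i 0 - L (A j 0)) = A i 0 := by
        simp only [sub_eq_add_neg, ← map_neg]
        rw [mean_add, mean_const]
        have := mean_map (-L.toLinearEquiv.toLinearMap) fun j => A j 0
        rw [h.mean_apply, map_zero] at this
        simpa using this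
      rw [this]
    have h2 : (mean fun j => (‖A i (A j 0)‖ ^ 2 + κ * R * (‖A i 0 - L (A j 0)‖ + -(ε * R)))) ≤
        mean fun j => 2 * (‖A i 0‖ ^ 2 + ‖A j 0‖ ^ 2) := by
      refine mean_mono fun j => ?_
      have := hscale (A i 0) (L (A j 0)) (h.norm_le i) (by rw [L.norm_map]; exact h.norm_le j)
      rwa [← hA, L.norm_map] at this
    rw [mean_add, mean_const_mul, mean_add, mean_const, mean_const_mul, mean_add, mean_const] at h2
    have h3 := mul_le_mul_of_nonneg_left h1 (mul_pos hκ hR).le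
    linarith
  have := mean_mono hstep
  rw [mean_add, mean_const_mul, mean_const_mul, mean_add, mean_const] at this
  simp only [sub_eq_add_neg] at this
  rw [mean_add, mean_const] at this
  rw [mean_prod]
  change (mean fun i => mean fun j => ‖A i (A j 0)‖ ^ 2) + _ ≤ _
  linarith

end IsDriftingWalk

end Banach

/-! ### Banach spaces: absence of translations -/

section Banach

variable {E : Type u} [NormedAddCommGroup E] [NormedSpace ℝ E]

/-- Random walks as above have no drift in uniformly convex spaces: otherwise the second moment
after `2 ^ j` steps, divided by `4 ^ j`, would decrease by a fixed amount with each doubling. -/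
theorem IsDriftingWalk.drift_eq_zero {ι : Type*} [Fintype ι] [Nonempty ι] {A : ι → E ≃ᵃⁱ[ℝ] E}
    {o u : E} {R : ℝ} (h : IsDriftingWalk A o u R) (hR : 0 < R)
    (hconv : ∀ ε : ℝ, 0 < ε → ∃ κ > 0, ∀ a b : E, ‖a‖ ≤ 1 → ‖b‖ ≤ 1 →
      ‖a + b‖ ^ 2 + κ * (‖a - b‖ - ε) ≤ 2 * (‖a‖ ^ 2 + ‖b‖ ^ 2)) : u = 0 := by
  by_contra hu
  have hu : 0 < ‖u‖ := norm_pos_iff.2 hu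
  -- With this choice, the error `ε * R` is half of the bound `‖u‖ / 2` for the mean displacement.
  obtain ⟨κ, hκ, hconv⟩ := hconv (‖u‖ / (4 * R)) (by positivity)
  have hnorm : ∀ j : ℕ, ‖(2 : ℝ) ^ j • u‖ = 2 ^ j * ‖u‖ := fun j => by
    rw [norm_smul, Real.norm_of_nonneg (by positivity)]
  -- From `2 ^ j₀` steps on, the distance of `o` from the origin is negligible against the drift.
  obtain ⟨j₀, hj₀⟩ : ∃ j₀ : ℕ, 2 * ‖o‖ ≤ 2 ^ j₀ * ‖u‖ / 2 := by
    obtain ⟨j₀, hj₀⟩ := pow_unbounded_of_one_lt (4 * ‖o‖ / ‖u‖) one_lt_two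
    refine ⟨j₀, ?_⟩
    rw [div_lt_iff₀ hu] at hj₀
    linarith
  -- Each doubling yields a walk on the same space with twice the drift and twice the bound.
  have hdouble : ∀ j : ℕ, ∃ (ι' : Type _) (_ : Fintype ι') (_ : Nonempty ι') (B : ι' → E ≃ᵃⁱ[ℝ] E),
      IsDriftingWalk B o ((2 : ℝ) ^ j • u) (2 ^ j * R) := by
    intro j
    induction j with
    | zero => exact ⟨ι, _, ‹_›, A, by simpa using h⟩
    | succ j ih =>
      obtain ⟨ι', _, _, B, hB⟩ := ih
      refine ⟨ι' × ι', inferInstance, inferInstance, fun p => (B p.2).trans (B p.1), ?_⟩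
      have := hB.prod
      rwa [smul_smul, ← mul_assoc, ← pow_succ'] at this
  have hstep : ∀ i : ℕ, ∃ (ι' : Type _) (_ : Fintype ι') (_ : Nonempty ι')
      (B : ι' → E ≃ᵃⁱ[ℝ] E), IsDriftingWalk B o ((2 : ℝ) ^ (j₀ + i) • u) (2 ^ (j₀ + i) * R) ∧
      (mean fun k => ‖B k 0‖ ^ 2) ≤ 4 ^ (j₀ + i) * (R ^ 2 - i * (κ * R * ‖u‖ / 16)) := by
    intro i
    induction i with
    | zero =>
      obtain ⟨ι', _, _, B, hB⟩ := hdouble j₀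
      refine ⟨ι', _, ‹_›, B, hB, ?_⟩
      refine (mean_mono fun k => pow_le_pow_left₀ (norm_nonneg _) (hB.norm_le k) 2).trans ?_
      rw [mean_const, mul_pow, ← pow_mul, mul_comm j₀ 2, pow_mul]
      norm_num
    | succ i ih =>
      obtain ⟨ι', _, _, B, hB, hle⟩ := ih
      refine ⟨ι' × ι', inferInstance, inferInstance, fun p => (B p.2).trans (B p.1), ?_, ?_⟩
      · have := hB.prod
        rwa [smul_smul, ← mul_assoc, ← pow_succ'] at this
      · have hsq := hB.mean_sq_prod_le (by positivity) hκ hconv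
        have hdrift := hB.norm_drift_le
        rw [hnorm] at hdrift
        have hmono : (2 : ℝ) ^ j₀ ≤ 2 ^ (j₀ + i) :=
          pow_le_pow_right₀ one_le_two (Nat.le_add_right _ _)
        have hmono' := mul_le_mul_of_nonneg_right hmono hu.le
        have hfour : (4 : ℝ) ^ (j₀ + i) = 2 ^ (j₀ + i) * 2 ^ (j₀ + i) := by
          rw [← mul_pow]
          norm_num
        have hε : ‖u‖ / (4 * R) * (2 ^ (j₀ + i) * R) = 2 ^ (j₀ + i) * ‖u‖ / 4 := by
          field_simp
        rw [hε] at hsq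
        have hgain : κ * (2 ^ (j₀ + i) * R) * (2 ^ (j₀ + i) * ‖u‖ / 4) ≤
            κ * (2 ^ (j₀ + i) * R) *
              ((mean fun k => ‖B k 0‖) - 2 ^ (j₀ + i) * ‖u‖ / 4) :=
          mul_le_mul_of_nonneg_left (by linarith) (by positivity)
        rw [← add_assoc, pow_succ]
        push_cast
        have : κ * (2 ^ (j₀ + i) * R) * (2 ^ (j₀ + i) * ‖u‖ / 4) =
            4 ^ (j₀ + i) * (κ * R * ‖u‖ / 4) := by
          rw [hfour]
          ring
        linarith
  obtain ⟨i, hi⟩ := exists_nat_gt (R ^ 2 / (κ * R * ‖u‖ / 16))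
  obtain ⟨ι', _, _, B, -, hle⟩ := hstep i
  rw [div_lt_iff₀ (by positivity)] at hi
  have h1 : 0 ≤ mean fun k => ‖B k 0‖ ^ 2 := mean_nonneg fun k => sq_nonneg _
  have h2 : (4 : ℝ) ^ (j₀ + i) * (R ^ 2 - i * (κ * R * ‖u‖ / 16)) < 0 :=
    mul_neg_of_pos_of_neg (by positivity) (by linarith)
  linarith

/-- In a uniformly convex space, a vector that is invariant under linear isometries `L` cannot be
a sum of vectors `L y - y`, unless it is zero. The walk with steps `z ↦ L k (z + y k) - m`, where
`m` is the mean of the `L k (y k)`, is centred, and its inverse has drift `v / n` at `-m`. -/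
theorem eq_zero_of_sum_sub_eq {n : ℕ} (L : Fin n → E ≃ₗᵢ[ℝ] E) (y : Fin n → E) {v : E}
    (hv : ∀ k, L k v = v) (hsum : ∑ k, (L k (y k) - y k) = v)
    (hconv : ∀ ε : ℝ, 0 < ε → ∃ κ > 0, ∀ a b : E, ‖a‖ ≤ 1 → ‖b‖ ≤ 1 →
      ‖a + b‖ ^ 2 + κ * (‖a - b‖ - ε) ≤ 2 * (‖a‖ ^ 2 + ‖b‖ ^ 2)) : v = 0 := by
  rcases isEmpty_or_nonempty (Fin n) with hn | hn
  · rw [← hsum, Finset.univ_eq_empty, Finset.sum_empty]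
  let m : E := mean fun k => L k (y k)
  let A : Fin n → E ≃ᵃⁱ[ℝ] E := fun k =>
    ((AffineIsometryEquiv.constVAdd ℝ E (y k)).trans (L k).toAffineIsometryEquiv).trans
      (AffineIsometryEquiv.constVAdd ℝ E (-m))
  have hA : ∀ k z, A k z = -m + L k (y k + z) := fun k z => rfl
  have hA' : ∀ k, (A k).symm (-m) = -y k := fun k => by
    apply (A k).injective
    rw [AffineIsometryEquiv.apply_symm_apply, hA]
    simp
  have hm : (mean fun k => y k) = m - (n : ℝ)⁻¹ • v := by
    simp only [m, mean, Fintype.card_fin, ← hsum, Finset.sum_sub_distrib, smul_sub]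
    abel
  let R : ℝ := 1 + ∑ k, ‖A k 0‖
  have hR : 0 < R := by positivity
  have hwalk : IsDriftingWalk A (-m) ((n : ℝ)⁻¹ • v) R :=
    { linear_apply := fun k => by
        rw [map_smul]
        congr 1
        exact hv k
      mean_apply := by
        simp only [hA, add_zero]
        rw [mean_add, mean_const]
        exact neg_add_cancel m
      mean_symm_apply := by
        simp only [hA']
        have := mean_map (-LinearMap.id : E →ₗ[ℝ] E) y
        simp only [LinearMap.neg_apply, LinearMap.id_apply] at this
        rw [this, hm]
        abel
      norm_le := fun k => by
        have := Finset.single_le_sum (f := fun k => ‖A k 0‖) (fun _ _ => norm_nonneg _)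
          (Finset.mem_univ k)
        simp only [R]
        linarith }
  have := hwalk.drift_eq_zero hR hconv
  have hn0 : (n : ℝ) ≠ 0 := by
    have := Fintype.card_ne_zero (α := Fin n)
    rw [Fintype.card_fin] at this
    exact_mod_cast this
  exact (smul_eq_zero.1 this).resolve_left (inv_ne_zero hn0)

variable {G : Type v} [Group G]

/-- A translation of a point of a uniformly convex Banach space moves it by an invariant vector `v`.
If subgroups with fixed points generate the group, then `v` is a sum of vectors `L y - y` with
linear parts `L` of group elements, and so vanishes. -/
theorem IsBanach.apply_eq_of_mem_translations {𝒳 : Set MSpace.{u}} (hU : StableUltraproduct 𝒳)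
    (hgeo : ∀ X ∈ 𝒳, UniquelyGeodesic X) {X : MSpace.{u}} (hX : X ∈ 𝒳) (hB : IsBanach X)
    {h2 : NPC2 X} {hT : TP X} {α : G →* (X ≃ᵢ X)} {x : X} {h : G}
    (hh : h ∈ translations h2 hT α x) {ι : Type*} {M : ι → Subgroup G}
    (hgen : Subgroup.closure (⋃ i, (M i : Set G)) = ⊤)
    (hfix : ∀ i, (fixedSet α (M i)).Nonempty) : α h x = x := by
  obtain ⟨E, _, _, -, ⟨e⟩⟩ := hB
  have hE : UniquelyGeodesic E := (hgeo X hX).of_isometryEquiv e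
  let A : G → E ≃ᵃⁱ[ℝ] E := fun g => ((e.symm.trans (α g)).trans e).toRealAffineIsometryEquiv
  let L : G → E ≃ₗᵢ[ℝ] E := fun g => (A g).linearIsometryEquiv
  have hA : ∀ g z, A g (e z) = e (α g z) := fun g z => by
    simp [A]
  have hL : ∀ g z w, L g (e z - e w) = e (α g z) - e (α g w) := fun g z w => by
    rw [← hA, ← hA]
    exact (A g).map_vsub (e z) (e w)
  have hv : ∀ g, L g (e (α h x) - e x) = e (α h x) - e x := fun g => by
    have := ((hh g).map e.isometry).sub_eq_sub hE
    rwa [map_mul, IsometryEquiv.mul_apply, ← hL] at this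
  let N : Submodule ℝ E := Submodule.span ℝ {z | ∃ g y, L g y - y = z}
  have hmemN : ∀ g y, L g y - y ∈ N := fun g y => Submodule.subset_span ⟨g, y, rfl⟩
  have hN : ∀ g, e (α g x) - e x ∈ N := by
    intro g
    have hg : g ∈ Subgroup.closure (⋃ i, (M i : Set G)) := hgen ▸ Subgroup.mem_top g
    induction hg using Subgroup.closure_induction with
    | mem m hm =>
      obtain ⟨j, hj⟩ := Set.mem_iUnion.1 hm
      obtain ⟨z, hz⟩ := hfix j
      have h1 := hmemN m (e x - e z)
      rw [hL, hz m hj] at h1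
      convert h1 using 1
      abel
    | one => simp
    | mul g k _ _ ihg ihk =>
      have h1 := add_mem (add_mem (hmemN g (e (α k x) - e x)) ihk) ihg
      rw [hL] at h1
      convert h1 using 1
      rw [map_mul, IsometryEquiv.mul_apply]
      abel
    | inv g _ ih =>
      have h1 := neg_mem (add_mem (hmemN g⁻¹ (e (α g x) - e x)) ih)
      rw [hL, ← IsometryEquiv.mul_apply, ← map_mul, inv_mul_cancel, map_one,
        IsometryEquiv.coe_one, id] at h1
      convert h1 using 1
      abel
  obtain ⟨n, c, f, hf⟩ := (Submodule.mem_span_set').1 (hN h)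
  choose g y hgy using fun k => (f k).2
  have hzero := eq_zero_of_sum_sub_eq (fun k => L (g k)) (fun k => c k • y k) (fun k => hv (g k))
    (by simpa only [map_smul, ← smul_sub, hgy] using hf)
    fun ε hε => exists_uniform_convexity hU hgeo hX e hε
  exact e.injective (sub_eq_zero.1 hzero)

end Banach

end Synthesis

theorem mainTheorem3 {G : Type v} [Group G] [Group.FG G]
    (𝒳 : Set Synthesis.MSpace.{u})
    (hS : Synthesis.StableScaleUp 𝒳) (hU : Synthesis.StableUltraproduct 𝒳)
    (Θ : ℝ≥0 → ℝ≥0) (hΘ_mono : StrictMono Θ) (hΘ_cont : Continuous Θ)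
    (hNPC1 : ∀ X ∈ 𝒳, Synthesis.ThetaNPC1 X Θ)
    (hNPC2 : ∀ X ∈ 𝒳, Synthesis.NPC2 X)
    (hNPC3 : ∀ X ∈ 𝒳, Synthesis.NPC3 X)
    (hTP : ∀ X ∈ 𝒳, Synthesis.TP X)
    (l : ℕ) (hl : 3 ≤ l) (M : Fin l → Subgroup G) (Φ : Subgroup (MulAut G))
    (hgen : Subgroup.closure (⋃ i, (M i : Set G)) = ⊤)
    (hfin : Finite Φ)
    (hrel : ∀ i, Synthesis.RelPropertyF 𝒳 (M i)) :
    (Synthesis.WinsGame M Φ → Synthesis.PropertyF G 𝒳) ∧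
    (((∀ X ∈ 𝒳, Synthesis.IsBanach X) ∨ (∀ X ∈ 𝒳, Synthesis.IsCAT0 X)) →
      Synthesis.WinsGamePlus M Φ → Synthesis.PropertyF G 𝒳) := by
  refine ⟨fun ⟨H, hgame, i, hi⟩ => ?_, fun hclass ⟨H, hgame, i, hi⟩ => ?_⟩
  · refine Synthesis.propertyF_of_reflTransGen hS hU hΘ_mono hΘ_cont hNPC1 hNPC2 hTP hgen hrel
      (fun H H' hstep => hstep.imp_left fun ⟨P, htors, hmove⟩ => ⟨P, ?_, hmove⟩) hgame hi
    intro X hX α x hP h hh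
    exact Synthesis.apply_eq_of_isMulTorsion (hNPC3 X hX) ((Subgroup.closure_le _).2 hP) htors
      (Subgroup.subset_closure hh)
  · refine Synthesis.propertyF_of_reflTransGen hS hU hΘ_mono hΘ_cont hNPC1 hNPC2 hTP hgen hrel
      (fun H H' hstep => hstep.imp_left fun ⟨P, hmove⟩ => ⟨P, ?_, hmove⟩) hgame hi
    intro X hX α x hP h hh
    rcases hclass with hB | hC
    · exact Synthesis.IsBanach.apply_eq_of_mem_translations hU (fun X hX => (hNPC1 X hX).1) hX
        (hB X hX) (hP hh) hgen fun i => hrel i X hX α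
    · exact Synthesis.IsCAT0.apply_eq_of_mem_translations (hC X hX) (hNPC3 X hX) (hP hh) hgen
        fun i => hrel i X hX α
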